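/- For an integer $n\ge 1$ let $$\Phi_n(q)=[n]_q+\cfrac{q^{n}}{[n]_{q^{-1}}+\cfrac{q^{-n}}{[n]_q+\cfrac{q^{n}}{[n]_{q^{-1}}+\cfrac{q^{-n}}{[n]_q+\ddots}}}},\qquad [n]_t=1+t+\cdots+t^{n-1},$$ be the $q$-deformation of the metallic number $\frac{n+\sqrt{n^2+4}}2$. The continued fraction converges in the field of formal Laurent series in $q$ and its value is a power series $\Phi_n(q)=\sum_{i\ge0}f_iq^i$. Let $\Delta_j=\det(f_{a+b})_{0\le a,b<j}$ be its Hankel determinants, with $\Delta_0=1$. The $H$-fraction expansion of $\Phi_n$ over $\mathbb Q$ is its expansion $$\Phi_n(q)=\cfrac{v_0q^{k_0}}{1+q\,u_1(q)-\cfrac{v_1q^{k_0+k_1+2}}{1+q\,u_2(q)-\cfrac{v_2q^{k_1+k_2+2}}{1+q\,u_3(q)-\ddots}}}$$ with $v_i\in\mathbb Q\setminus\{0\}$, $k_i\in\mathbb Z_{\ge0}$, $u_i\in\mathbb Q[q]$, $\deg u_i\le k_{i-1}$. Put $s_0=0$ and $s_p=p+k_0+\cdots+k_{p-1}$ for $p\ge1$.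 (1) Let $n\ge2$. Then $\Phi_n$ has such an expansion, and the following holds. Among $\Delta_0,\Delta_1,\dots,\Delta_{2n(n+1)-1}$ the nonzero determinants are exactly the $\Delta_{s_q}$ with $0\le q\le 6n-5$, and their values are $$\Delta_{s_{3p}}=\begin{cases}(-1)^{p\frac{n(n-1)}2}(-1)^{\frac{p(p-1)}2}&\text{if }0\le p\le n-1,\\(-1)^{\frac{n(n+1)(n+2)}2}&\text{if }p=n,\\(-1)^{(p+1)\frac{n(n-1)}2}(-1)^n&\text{if }n+1\le p\le 2n-2;\end{cases}$$ $$\Delta_{s_{3p+1}}=(-1)^{p\frac{n(n-1)}2}(-1)^{\frac{p(p+1)}2}\quad\text{if }0\le p\le 2n-2;$$ $$\Delta_{s_{3p+2}}=\begin{cases}(-1)^{(p+1)\frac{n(n-1)}2}&\text{if }0\le p\le n-2,\\(-1)^{\frac{n(n-1)^2}2}&\text{if }p=n-1,\\(-1)^{p\frac{n(n-1)}2}(-1)^{\frac{(p+1)(p+2)}2}&\text{if }n\le p\le 2n-3.\end{cases}$$ (2) For every $n\ge1$, $$\Delta_j=(-1)^{\frac{n(n+1)}2}\,\Delta_{(2n+1)(n+1)-j}\qquad\text{for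 }0\le j\le(2n+1)(n+1).$$ -/

import Mathlib

/-- The finite continued fraction `α₀ / (β₀ + α₁ / (β₁ + ⋯ + α_{m-1} / β_{m-1}))`
with `m` partial quotients (it is `0` when `m = 0`). -/
def cfracValue {K : Type*} [Field K] : (ℕ → K) → (ℕ → K) → ℕ → K
  | _, _, 0 => 0
  | α, β, m + 1 =>
      α 0 / (β 0 + cfracValue (fun i => α (i + 1)) (fun i => β (i + 1)) m)

/-- Convergence of a sequence of formal Laurent series in the `q`-adic topology: for every `N`,
the coefficients of index `< N` of the sequence are eventually those of the limit. -/
def LaurentTendsto {𝔽 : Type*} [Field 𝔽] (x : ℕ → LaurentSeries 𝔽) (F : LaurentSeries 𝔽) :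
    Prop :=
  ∀ N : ℤ, ∀ᶠ m in Filter.atTop, ∀ i : ℤ, i < N → (x m).coeff i = F.coeff i

theorem LaurentTendsto.unique {𝔽 : Type*} [Field 𝔽] {x : ℕ → LaurentSeries 𝔽}
    {F G : LaurentSeries 𝔽} (hF : LaurentTendsto x F) (hG : LaurentTendsto x G) : F = G := by
  ext i
  obtain ⟨m, h1, h2⟩ := ((hF (i + 1)).and (hG (i + 1))).exists
  rw [← h1 i (by omega), ← h2 i (by omega)]

/-- The Euler-Gauss integer `[n]_t = 1 + t + ⋯ + t^{n-1}` in a field, for a parameter `t`. -/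
def qInt {K : Type*} [Field K] (t : K) (n : ℕ) : K :=
  ∑ i ∈ Finset.range n, t ^ i

/-- The indeterminate `q` of the field of formal Laurent series over `ℚ`. -/
noncomputable def qVar : LaurentSeries ℚ := HahnSeries.single 1 1

/-- Partial numerators `q^n, q^{-n}, q^n, q^{-n}, …` of the `q`-metallic number. -/
noncomputable def metallicNum (n i : ℕ) : LaurentSeries ℚ :=
  if Even i then qVar ^ n else qVar⁻¹ ^ n

/-- Partial denominators `[n]_{q⁻¹}, [n]_q, [n]_{q⁻¹}, [n]_q, …` of the `q`-metallic number. -/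
noncomputable def metallicDen (n i : ℕ) : LaurentSeries ℚ :=
  if Even i then qInt qVar⁻¹ n else qInt qVar n

/-- `Φ` is the (Taylor series of the) `q`-deformation of the metallic number
`(n + √(n² + 4)) / 2 = n + 1 / (n + 1 / (n + ⋯))`, i.e. the value of the `2`-periodic
continued fraction `[n]_q + q^n / ([n]_{q⁻¹} + q^{-n} / ([n]_q + q^n / ([n]_{q⁻¹} + ⋯)))`. -/
def IsQMetallic (n : ℕ) (Φ : PowerSeries ℚ) : Prop :=
  LaurentTendsto
    (fun m => qInt qVar n + cfracValue (metallicNum n) (metallicDen n) m)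
    (Φ : LaurentSeries ℚ)

/-- The Hankel determinant `Δ_j^{(ℓ)}(f)`: the `j × j` determinant with entries
`f_{ℓ + a + b}`, `0 ≤ a, b < j`. It equals `1` for `j = 0`. -/
def hankelDet {R : Type*} [CommRing R] (f : ℕ → R) (ℓ j : ℕ) : R :=
  Matrix.det (Matrix.of fun a b : Fin j => f (ℓ + a + b))

/-- The data of an infinite Hankel continued fraction (`H`-fraction)
```
  v₀ q^{k₀}      -v₁ q^{k₀+k₁+2}     -v₂ q^{k₁+k₂+2}
------------- + ----------------- + ----------------- + ⋯
 1 + q u₁(q)       1 + q u₂(q)         1 + q u₃(q)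
```
with `vᵢ ≠ 0`, `kᵢ ≥ 0` and `deg uᵢ ≤ kᵢ₋₁`. The polynomial `u_{i+1}` is stored as `u i`. -/
structure HFraction (𝔽 : Type*) [Field 𝔽] where
  k : ℕ → ℕ
  v : ℕ → 𝔽
  u : ℕ → Polynomial 𝔽
  v_ne_zero : ∀ i, v i ≠ 0
  natDegree_u_le : ∀ i, (u i).natDegree ≤ k i

namespace HFraction

variable {𝔽 : Type*} [Field 𝔽]

/-- The partial numerators of an `H`-fraction. -/
noncomputable def num (H : HFraction 𝔽) : ℕ → Polynomial 𝔽
  | 0 => Polynomial.monomial (H.k 0) (H.v 0)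
  | i + 1 => Polynomial.monomial (H.k i + H.k (i + 1) + 2) (-H.v (i + 1))

/-- The partial denominators of an `H`-fraction. -/
noncomputable def den (H : HFraction 𝔽) (i : ℕ) : Polynomial 𝔽 :=
  1 + Polynomial.X * H.u i

/-- The power series `F` is the value of the infinite continued fraction `H`. -/
def IsExpansionOf (H : HFraction 𝔽) (F : PowerSeries 𝔽) : Prop :=
  LaurentTendsto
    (cfracValue (fun i => ((H.num i : PowerSeries 𝔽) : LaurentSeries 𝔽))
      (fun i => ((H.den i : PowerSeries 𝔽) : LaurentSeries 𝔽)))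
    (F : LaurentSeries 𝔽)

/-- The integers `s_p = p + k₀ + k₁ + ⋯ + k_{p-1}`. -/
def s (H : HFraction 𝔽) (p : ℕ) : ℕ :=
  p + ∑ i ∈ Finset.range p, H.k i

end HFraction

/-!
Write `T = 1 - q + q²`, and let `G` be the power series with `q^n T G² + T [n]_q G = 1`. The
`q`-metallic number is `Φ = 1 / (1 - q + q^n T G)`: this element satisfies the quadratic equation
of `Φ`, and the convergents of the defining continued fraction approach it because two steps
contract the error by `q^{2n}` (`isQMetallic_quotE`).

*Hankel determinants along a division step.* Suppose `F = v q^k / h` with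
`h = 1 + q u - q^{k+2} F'` and `deg u ≤ k`. Multiplying the Hankel matrix of `F` by the
unitriangular Toeplitz matrix of `h` and by its transpose gives a block diagonal matrix, with an
antitriangular block of size `k + 1` followed by `v` times the Hankel matrix of `F'`
(`hankelDet_add_of_conv`). Hence along a chain of division steps the nonzero Hankel determinants
sit exactly at the positions `p + k_0 + ⋯ + k_{p-1}`, and their values are explicit products
(`hankel_chain`, `hankel_chain_ne_zero_iff`). Each Hankel determinant depends on finitely many
coefficients, so for an arbitrary `H`-fraction one may replace the series by a convergent; in
particular any two `H`-fractions of the same series have the same positions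
(`HFraction.IsExpansionOf.hankel_ne_zero_iff`, `eq_of_same_values`).

*The complete quotients of `Φ`.* By the quadratic equation of `G`, three division steps lead from
`-q^p G` to `-q^{p+1} G` as long as `p + 3 ≤ n`, and from `-q^r T G` to `-q^{r+1} T G` in the same
range. These two runs make up the first and the second half of the expansion. They are joined by
five central steps, whose central complete quotient has the closed form `X_pow_mul_quotJ`. The
chain of the first `6n - 1` steps is `isHStep_metallic`. For `n ≥ 2` it ends at the complete
quotient of index `3` (`metallicF_periodic`), so the expansion is periodic and continues to an
infinite `H`-fraction.

*Signs and symmetry.* The exponents `k_i` and the partial products of the `v_i` are palindromic for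
`0 ≤ i ≤ 6n - 2`, so the product of two determinants in symmetric positions is constant, and it is
read off at the center (`metallicSign_symm`). The individual values follow by induction along the
two runs, using `tri (a + b) = tri a + tri b + a b` for the triangular numbers.
-/

/-! ### Hankel determinants along one step of an `H`-fraction -/

section HankelStep

variable {R : Type*} [CommRing R]

theorem hankelDet_congr {f g : ℕ → R} {j : ℕ} (h : ∀ i, i < 2 * j → f i = g i) :
    hankelDet f 0 j = hankelDet g 0 j := by
  unfold hankelDet
  congr 1
  ext a b
  simp only [Matrix.of_apply, zero_add]
  exact h _ (by have := a.2; have := b.2; omega)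

/-- A Hankel matrix which vanishes above the antidiagonal. -/
theorem hankelDet_antitriangular (c : R) (k : ℕ) : ∀ g : ℕ → R, (∀ i < k, g i = 0) → g k = c →
    hankelDet g 0 (k + 1) = (-1) ^ (k * (k + 1) / 2) * c ^ (k + 1) := by
  induction k with
  | zero => intro g _ hc; simp [hankelDet, hc]
  | succ k ih =>
    intro g h0 hc
    have hs := ih (fun i => g (i + 1)) (fun i hi => h0 _ (by omega)) hc
    have htri : (k + 1) * (k + 1 + 1) / 2 = k * (k + 1) / 2 + (k + 1) := by
      rw [show (k + 1) * (k + 1 + 1) = k * (k + 1) + (k + 1) * 2 by ring,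
        Nat.add_mul_div_right _ _ two_pos]
    unfold hankelDet at hs ⊢
    rw [Matrix.det_succ_row_zero, Finset.sum_eq_single (Fin.last (k + 1))]
    · have hsub : (Matrix.of fun a b : Fin (k + 1 + 1) => g (0 + a + b)).submatrix Fin.succ
          (Fin.last (k + 1)).succAbove =
          Matrix.of fun a b : Fin (k + 1) => g (0 + a + b + 1) := by
        ext a b
        simp only [Matrix.submatrix_apply, Matrix.of_apply, Fin.succAbove_last, Fin.val_succ,
          Fin.val_castSucc]
        congr 1
        omega
      rw [hsub, hs, htri]
      simp only [Matrix.of_apply, Fin.val_last, Fin.val_zero, zero_add, hc, pow_add, pow_one]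
      ring
    · intro b _ hb
      have : (b : ℕ) < k + 1 := by
        have := b.2
        have : (b : ℕ) ≠ k + 1 := fun h => hb (Fin.ext (by simpa using h))
        omega
      simp only [Matrix.of_apply, Fin.val_zero, zero_add, h0 _ this]
      ring
    · simp

/-- If the Cauchy product of `h` and `f` is `v q^k`, then multiplying the Hankel matrix of `f` by
the triangular Toeplitz matrix of `h` on the left and by its transpose on the right gives a block
diagonal matrix: an antitriangular block of size `k + 1`, then `-v` times the Hankel matrix of the
coefficients of `h` from index `k + 2` on. This is the formula for its entries. -/
theorem toeplitz_hankel_toeplitz_apply {f h : ℕ → R} {k : ℕ} {v : R}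
    (hc : ∀ m, ∑ i ∈ Finset.range (m + 1), h (m - i) * f i = if m = k then v else 0) (a b : ℕ) :
    ∑ d ∈ Finset.range (b + 1), h (b - d) * ∑ c ∈ Finset.range (a + 1), h (a - c) * f (c + d) =
      v * ((if a ≤ k ∧ k ≤ a + b then h (a + b - k) else 0) -
        (if k < b then h (a + b - k) else 0)) := by
  induction a generalizing b with
  | zero =>
    have : ∀ d, h (b - d) * ∑ c ∈ Finset.range (0 + 1), h (0 - c) * f (c + d) =
        h 0 * (h (b - d) * f d) := fun d => by simp; ring
    simp only [this, ← Finset.mul_sum, hc]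
    rcases lt_trichotomy b k with hb | rfl | hb
    · simp [hb.ne, hb.le, hb.not_ge]
    · simp [mul_comm]
    · simp [hb.ne', hb, hb.le]
  | succ a ih =>
    -- with `c = h * f`, the entries satisfy
    -- `M (a + 1) b = M a (b + 1) + h (a + 1) * c b - h (b + 1) * c a`
    have hR : ∀ d, ∑ c ∈ Finset.range (a + 1 + 1), h (a + 1 - c) * f (c + d) =
        (∑ c ∈ Finset.range (a + 1), h (a - c) * f (c + (d + 1))) + h (a + 1) * f d := fun d => by
      rw [Finset.sum_range_succ']
      congr 1
      · refine Finset.sum_congr rfl fun c _ => ?_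
        rw [Nat.add_sub_add_right, add_right_comm, add_assoc]
      · simp
    have hb := ih (b + 1)
    rw [Finset.sum_range_succ'] at hb
    simp only [Nat.add_sub_add_right, add_zero, hc, Nat.sub_zero] at hb
    simp only [hR, mul_add, Finset.sum_add_distrib]
    rw [eq_sub_of_add_eq hb]
    have h2 : ∑ d ∈ Finset.range (b + 1), h (b - d) * (h (a + 1) * f d) =
        h (a + 1) * ∑ d ∈ Finset.range (b + 1), h (b - d) * f d := by
      rw [Finset.mul_sum]
      exact Finset.sum_congr rfl fun d _ => by ring
    rw [h2, hc, show a + 1 + b = a + (b + 1) by ring]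
    rcases lt_trichotomy a k with ha | rfl | ha
    · rcases lt_trichotomy b k with hb | rfl | hb
      · have : ¬ k < b + 1 := by omega
        simp [ha.ne, ha.le, hb.ne, hb.not_gt, this, Nat.succ_le_of_lt ha]
      · simp [ha.ne, ha.le, Nat.succ_le_of_lt ha, show b ≤ a + (b + 1) by omega,
          show a + (b + 1) - b = a + 1 by omega]
        ring
      · simp [ha.ne, ha.le, Nat.succ_le_of_lt ha, show k ≤ a + (b + 1) by omega, hb.ne', hb,
          show k < b + 1 by omega]
    · rcases lt_trichotomy b a with hb | rfl | hb
      · have : ¬ a < b + 1 := by omega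
        simp [hb.ne, hb.not_gt, this]
        ring
      · simp
      · simp [hb.ne', hb, show a < b + 1 by omega]
        ring
    · rcases lt_trichotomy b k with hb | rfl | hb
      · have : ¬ k < b + 1 := by omega
        simp [ha.ne', ha.not_ge, hb.ne, hb.not_gt, this, show ¬ a + 1 ≤ k by omega]
      · simp [ha.ne', ha.not_ge, show ¬ a + 1 ≤ b by omega,
          show a + (b + 1) - b = a + 1 by omega]
        ring
      · simp [ha.ne', ha.not_ge, hb.ne', hb, show ¬ a + 1 ≤ k by omega, show k < b + 1 by omega]

theorem det_toeplitz_mul_hankel_mul {f h : ℕ → R} (h0 : h 0 = 1) (j : ℕ) :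
    hankelDet f 0 j = Matrix.det (Matrix.of fun a b : Fin j =>
      ∑ d ∈ Finset.range (b + 1), h (b - d) *
        ∑ c ∈ Finset.range (a + 1), h (a - c) * f (c + d)) := by
  obtain ⟨L, hL⟩ : ∃ L : Matrix (Fin j) (Fin j) R,
    ∀ a c : Fin j, L a c = if (c : ℕ) ≤ a then h (a - c) else 0 := ⟨Matrix.of _, fun _ _ => rfl⟩
  have hsum : ∀ (a : Fin j) (g : ℕ → R), ∑ c : Fin j, L a c * g c =
      ∑ c ∈ Finset.range (a + 1), h (a - c) * g c := by
    intro a g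
    have : ∑ c : Fin j, L a c * g c =
        ∑ c ∈ Finset.range j, (if c ≤ (a : ℕ) then h (a - c) else 0) * g c := by
      rw [Finset.sum_range]
      exact Finset.sum_congr rfl fun c _ => by rw [hL]
    rw [this, ← Finset.sum_subset (s₁ := Finset.range (a + 1))]
    · refine Finset.sum_congr rfl fun c hc => ?_
      rw [if_pos (by simpa [Nat.lt_succ_iff] using hc)]
    · intro c hc
      have := a.2
      simp only [Finset.mem_range] at hc ⊢
      omega
    · intro c _ hc
      rw [if_neg (by simpa [Nat.lt_succ_iff] using hc), zero_mul]
  have hdet : L.det = 1 := by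
    rw [Matrix.det_of_isLowerTriangular]
    · simp [hL, h0]
    · intro a b hab
      rw [hL]
      exact if_neg (not_le.2 (by simpa using hab))
  have hM : (Matrix.of fun a b : Fin j => ∑ d ∈ Finset.range (b + 1), h (b - d) *
        ∑ c ∈ Finset.range (a + 1), h (a - c) * f (c + d)) =
      L * (Matrix.of fun a b : Fin j => f (0 + a + b)) * L.transpose := by
    ext a b
    rw [Matrix.of_apply, ← hsum b, Matrix.mul_apply]
    refine Finset.sum_congr rfl fun d _ => ?_
    rw [← hsum a fun c => f (c + d), Matrix.mul_apply, Matrix.transpose_apply, mul_comm]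
    simp only [Matrix.of_apply, zero_add]
  rw [hM, Matrix.det_mul, Matrix.det_mul, Matrix.det_transpose, hdet]
  simp [hankelDet]

/-- Hankel determinants vanish as long as their order does not reach the block of size `k + 1`. -/
theorem hankelDet_eq_zero_of_conv {f h : ℕ → R} {k : ℕ} {v : R} (h0 : h 0 = 1)
    (hc : ∀ m, ∑ i ∈ Finset.range (m + 1), h (m - i) * f i = if m = k then v else 0)
    {j : ℕ} (hj : 1 ≤ j) (hjk : j ≤ k) : hankelDet f 0 j = 0 := by
  rw [det_toeplitz_mul_hankel_mul h0]
  apply Matrix.det_eq_zero_of_row_eq_zero ⟨0, hj⟩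
  intro b
  have := b.2
  rw [Matrix.of_apply, toeplitz_hankel_toeplitz_apply hc, if_neg (by simp; omega),
    if_neg (by omega)]
  simp

/-- The Schur reduction of Hankel determinants: splitting off the antitriangular block. -/
theorem hankelDet_add_of_conv {f h : ℕ → R} {k : ℕ} {v : R} (h0 : h 0 = 1)
    (hc : ∀ m, ∑ i ∈ Finset.range (m + 1), h (m - i) * f i = if m = k then v else 0) (i : ℕ) :
    hankelDet f 0 (k + 1 + i) = (-1) ^ (k * (k + 1) / 2) * v ^ (k + 1 + i) *
      hankelDet (fun t => - h (k + 2 + t)) 0 i := by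
  rw [det_toeplitz_mul_hankel_mul h0]
  set A : Matrix (Fin (k + 1)) (Fin (k + 1)) R :=
    Matrix.of fun a b => (fun t => if k ≤ t then v * h (t - k) else 0) (0 + a + b)
  set D : Matrix (Fin i) (Fin i) R := Matrix.of fun a b => - h (k + 2 + (0 + a + b))
  have hA : A.det = (-1) ^ (k * (k + 1) / 2) * v ^ (k + 1) :=
    hankelDet_antitriangular v k (fun t => if k ≤ t then v * h (t - k) else 0)
      (fun i hi => if_neg (by omega)) (by simp [h0])
  have hM : (Matrix.of fun a b : Fin (k + 1 + i) => ∑ d ∈ Finset.range (b + 1), h (b - d) *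
      ∑ c ∈ Finset.range (a + 1), h (a - c) * f (c + d)).submatrix finSumFinEquiv finSumFinEquiv =
      Matrix.fromBlocks A 0 0 (v • D) := by
    ext x y
    rcases x with a | a <;> rcases y with b | b <;>
      simp only [Matrix.submatrix_apply, Matrix.of_apply, toeplitz_hankel_toeplitz_apply hc,
        finSumFinEquiv_apply_left, finSumFinEquiv_apply_right, Fin.val_castAdd, Fin.val_natAdd,
        Matrix.fromBlocks_apply₁₁, Matrix.fromBlocks_apply₁₂, Matrix.fromBlocks_apply₂₁,
        Matrix.fromBlocks_apply₂₂, A, D, Matrix.smul_apply, smul_eq_mul, Matrix.zero_apply,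
        zero_add] <;>
      have ha := a.2 <;> have hb := b.2
    · rw [if_neg (show ¬ k < (b : ℕ) by omega)]
      simp [show (a : ℕ) ≤ k by omega]
    · rw [if_pos (show (a : ℕ) ≤ k ∧ k ≤ a + (k + 1 + b) by omega),
        if_pos (show k < k + 1 + (b : ℕ) by omega), sub_self, mul_zero]
    · rw [if_neg (show ¬ (k + 1 + (a : ℕ) ≤ k ∧ k ≤ k + 1 + a + b) by omega),
        if_neg (show ¬ k < (b : ℕ) by omega), sub_self, mul_zero]
    · rw [if_neg (show ¬ (k + 1 + (a : ℕ) ≤ k ∧ k ≤ k + 1 + a + (k + 1 + b)) by omega),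
        if_pos (show k < k + 1 + (b : ℕ) by omega), zero_sub,
        show k + 1 + (a : ℕ) + (k + 1 + b) - k = k + 2 + (a + b) by omega]
  rw [← Matrix.det_submatrix_equiv_self finSumFinEquiv, hM, Matrix.det_fromBlocks_zero₂₁,
    Matrix.det_smul, hA, hankelDet, Fintype.card_fin]
  ring

end HankelStep

/-! ### Chains of division steps -/

section Chain

open PowerSeries

variable {𝔽 : Type*} [Field 𝔽]

/-- The `j`-th Hankel determinant of a power series. -/
noncomputable abbrev hankel (F : PowerSeries 𝔽) (j : ℕ) : 𝔽 :=
  hankelDet (fun i => F.coeff i) 0 j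

/-- `F = v q^k / (1 + q u - q^{k+2} F')` for some polynomial `u` of degree at most `k`: one step of
the expansion of `F` into an `H`-fraction, with complete quotient `F'`. The relation is written
without division. -/
def IsHStep (F F' : PowerSeries 𝔽) (k : ℕ) (v : 𝔽) : Prop :=
  v ≠ 0 ∧ ∃ u : Polynomial 𝔽, u.natDegree ≤ k ∧
    F * (1 + X * (u : PowerSeries 𝔽) - X ^ (k + 2) * F') = C v * X ^ k

theorem IsHStep.exists_conv {F F' : PowerSeries 𝔽} {k : ℕ} {v : 𝔽} (hs : IsHStep F F' k v) :
    ∃ h : ℕ → 𝔽, h 0 = 1 ∧ (∀ t, - h (k + 2 + t) = F'.coeff t) ∧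
      ∀ m, ∑ i ∈ Finset.range (m + 1), h (m - i) * F.coeff i = if m = k then v else 0 := by
  obtain ⟨_, u, hu, hF⟩ := hs
  refine ⟨fun i => (1 + X * (u : PowerSeries 𝔽) - X ^ (k + 2) * F').coeff i, ?_, fun t => ?_,
    fun m => ?_⟩
  · simp
  · have h1 : (X * (u : PowerSeries 𝔽)).coeff (k + 2 + t) = 0 := by
      rw [show k + 2 + t = (k + 1 + t) + 1 by ring, coeff_succ_X_mul, Polynomial.coeff_coe]
      exact Polynomial.coeff_eq_zero_of_natDegree_lt (by omega)
    have h2 : (X ^ (k + 2) * F').coeff (k + 2 + t) = F'.coeff t := by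
      rw [add_comm, coeff_X_pow_mul]
    have h3 : (1 : PowerSeries 𝔽).coeff (k + 2 + t) = 0 := by
      rw [coeff_one, if_neg (by omega)]
    simp only [map_sub, map_add, h1, h2, h3]
    ring
  · have := congrArg (coeff m) hF
    rw [coeff_C_mul, coeff_X_pow, coeff_mul, ← Finset.Nat.sum_antidiagonal_swap,
      Finset.Nat.sum_antidiagonal_eq_sum_range_succ_mk] at this
    rw [mul_ite, mul_one, mul_zero] at this
    rw [← this, ← Finset.sum_range_reflect]
    refine Finset.sum_congr rfl fun i hi => ?_
    have hi' : i ≤ m := by simpa [Nat.lt_succ_iff] using hi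
    simp only [Prod.swap_prod_mk, Nat.add_sub_cancel]
    rw [show m - (m - i) = i by omega]
    ring

theorem IsHStep.hankel_eq_zero {F F' : PowerSeries 𝔽} {k : ℕ} {v : 𝔽} (hs : IsHStep F F' k v)
    {j : ℕ} (hj : 1 ≤ j) (hjk : j ≤ k) : hankel F j = 0 := by
  obtain ⟨h, h0, _, hc⟩ := hs.exists_conv
  exact hankelDet_eq_zero_of_conv h0 hc hj hjk

theorem IsHStep.hankel_add {F F' : PowerSeries 𝔽} {k : ℕ} {v : 𝔽} (hs : IsHStep F F' k v)
    (i : ℕ) : hankel F (k + 1 + i) =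
      (-1) ^ (k * (k + 1) / 2) * v ^ (k + 1 + i) * hankel F' i := by
  obtain ⟨h, h0, h1, hc⟩ := hs.exists_conv
  rw [hankel, hankelDet_add_of_conv h0 hc, hankel]
  simp only [h1]

theorem IsHStep.neg {F F' : PowerSeries 𝔽} {k : ℕ} {v : 𝔽} (hs : IsHStep F F' k v) :
    IsHStep (-F) F' k (-v) := by
  obtain ⟨hv, u, hu, hF⟩ := hs
  refine ⟨neg_ne_zero.2 hv, u, hu, ?_⟩
  rw [neg_mul, hF, map_neg, neg_mul]

/-- The positions `p + k₀ + ⋯ + k_{p-1}` of the nonzero Hankel determinants. -/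
def hPos (k : ℕ → ℕ) (p : ℕ) : ℕ :=
  p + ∑ i ∈ Finset.range p, k i

/-- The nonzero Hankel determinant at position `hPos k p`, as a product over the steps: step `i`
contributes `(-1) ^ (k i * (k i + 1) / 2) * (v 0 ⋯ v i) ^ (k i + 1)`. -/
def hSign (k : ℕ → ℕ) (v : ℕ → 𝔽) : ℕ → 𝔽
  | 0 => 1
  | p + 1 => hSign k v p * (-1) ^ (k p * (k p + 1) / 2) *
      (∏ i ∈ Finset.range (p + 1), v i) ^ (k p + 1)

theorem hPos_zero (k : ℕ → ℕ) : hPos k 0 = 0 := by simp [hPos]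

theorem hPos_succ (k : ℕ → ℕ) (p : ℕ) : hPos k (p + 1) = hPos k p + (k p + 1) := by
  simp only [hPos, Finset.sum_range_succ]
  ring

theorem hPos_strictMono (k : ℕ → ℕ) : StrictMono (hPos k) :=
  strictMono_nat_of_lt_succ fun p => by rw [hPos_succ]; omega

theorem exists_hPos (k : ℕ → ℕ) {P j : ℕ} (hj : j ≤ hPos k P) :
    (∃ q ≤ P, j = hPos k q) ∨ ∃ q < P, ∃ i, 1 ≤ i ∧ i ≤ k q ∧ j = hPos k q + i := by
  induction P with
  | zero => exact Or.inl ⟨0, le_rfl, by rw [hPos_zero] at *; omega⟩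
  | succ P ih =>
    by_cases h : j ≤ hPos k P
    · rcases ih h with ⟨q, hq, rfl⟩ | ⟨q, hq, i, h1, h2, rfl⟩
      · exact Or.inl ⟨q, by omega, rfl⟩
      · exact Or.inr ⟨q, by omega, i, h1, h2, rfl⟩
    · rw [hPos_succ] at hj
      by_cases h' : j = hPos k (P + 1)
      · exact Or.inl ⟨P + 1, le_rfl, h'⟩
      · rw [hPos_succ] at h'
        exact Or.inr ⟨P, by omega, j - hPos k P, by omega, by omega, by omega⟩

variable {F : ℕ → PowerSeries 𝔽} {k : ℕ → ℕ} {v : ℕ → 𝔽} {P : ℕ}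

theorem hankel_chain_add (hF : ∀ i < P, IsHStep (F i) (F (i + 1)) (k i) (v i)) {p : ℕ}
    (hp : p ≤ P) (i : ℕ) : hankel (F 0) (hPos k p + i) =
      hSign k v p * (∏ t ∈ Finset.range p, v t) ^ i * hankel (F p) i := by
  induction p generalizing i with
  | zero => simp [hPos_zero, hSign]
  | succ p ih =>
    rw [hPos_succ, add_assoc, ih (by omega), (hF p (by omega)).hankel_add, hSign,
      Finset.prod_range_succ]
    ring

theorem hankel_chain (hF : ∀ i < P, IsHStep (F i) (F (i + 1)) (k i) (v i)) {p : ℕ}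
    (hp : p ≤ P) : hankel (F 0) (hPos k p) = hSign k v p := by
  have := hankel_chain_add hF hp 0
  simpa [hankel, hankelDet] using this

theorem hSign_ne_zero (hF : ∀ i < P, IsHStep (F i) (F (i + 1)) (k i) (v i)) {p : ℕ}
    (hp : p ≤ P) : hSign k v p ≠ 0 := by
  induction p with
  | zero => simp [hSign]
  | succ p ih =>
    rw [hSign]
    refine mul_ne_zero (mul_ne_zero (ih (by omega)) (by simp)) (pow_ne_zero _ ?_)
    exact Finset.prod_ne_zero_iff.2 fun i hi =>
      (hF i (by have := Finset.mem_range.1 hi; omega)).1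

theorem hankel_chain_eq_zero (hF : ∀ i < P, IsHStep (F i) (F (i + 1)) (k i) (v i)) {p i : ℕ}
    (hp : p < P) (h1 : 1 ≤ i) (h2 : i ≤ k p) : hankel (F 0) (hPos k p + i) = 0 := by
  rw [hankel_chain_add hF hp.le, (hF p hp).hankel_eq_zero h1 h2, mul_zero]

theorem hankel_chain_ne_zero_iff (hF : ∀ i < P, IsHStep (F i) (F (i + 1)) (k i) (v i)) {j : ℕ}
    (hj : j ≤ hPos k P) : hankel (F 0) j ≠ 0 ↔ ∃ q ≤ P, j = hPos k q := by
  constructor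
  · intro h
    rcases exists_hPos k hj with hq | ⟨q, hq, i, h1, h2, rfl⟩
    · exact hq
    · exact absurd (hankel_chain_eq_zero hF hq h1 h2) h
  · rintro ⟨q, hq, rfl⟩
    rw [hankel_chain hF hq]
    exact hSign_ne_zero hF hq

/-- Two strictly increasing enumerations of the same set of integers agree. -/
theorem eq_of_same_values {f g : ℕ → ℕ} (hf : StrictMono f) (hg : StrictMono g)
    (h : ∀ j ≤ g P, (∃ q, j = f q) ↔ ∃ q ≤ P, j = g q) {q : ℕ} (hq : q ≤ P) : f q = g q := by
  induction q using Nat.strong_induction_on with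
  | _ q ih =>
    obtain ⟨a, ha⟩ := (h (g q) (hg.monotone hq)).2 ⟨q, hq, rfl⟩
    have hqa : q ≤ a := by
      by_contra! hlt
      have := ih a hlt (by omega)
      have := hg hlt
      omega
    have hle : f q ≤ g q := ha ▸ hf.monotone hqa
    obtain ⟨b, hb, hfb⟩ := (h (f q) (hle.trans (hg.monotone hq))).1 ⟨q, rfl⟩
    have hqb : q ≤ b := by
      by_contra! hlt
      have := ih b hlt hb
      have := hf hlt
      omega
    exact le_antisymm hle (hfb ▸ hg.monotone hqb)

end Chain

/-! ### Convergence of continued fractions of power series -/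

section Convergence

open PowerSeries

variable {𝔽 : Type*} [Field 𝔽]

theorem laurentTendsto_coe {x : ℕ → PowerSeries 𝔽} {F : PowerSeries 𝔽}
    (h : ∀ m, (X : PowerSeries 𝔽) ^ m ∣ x m - F) :
    LaurentTendsto (fun m => (x m : LaurentSeries 𝔽)) (F : LaurentSeries 𝔽) := by
  intro N
  filter_upwards [Filter.eventually_ge_atTop N.toNat] with m hm i hi
  rw [PowerSeries.coeff_coe, PowerSeries.coeff_coe]
  split_ifs with h0
  · rfl
  · have := X_pow_dvd_iff.1 (h m) i.natAbs (by omega)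
    rw [map_sub] at this
    exact sub_eq_zero.1 this

theorem LaurentTendsto.exists_coeff_eq {x : ℕ → PowerSeries 𝔽} {F : PowerSeries 𝔽}
    (h : LaurentTendsto (fun m => (x m : LaurentSeries 𝔽)) (F : LaurentSeries 𝔽)) (N : ℕ) :
    ∃ m, N ≤ m ∧ ∀ i < N, (x m).coeff i = F.coeff i := by
  obtain ⟨m, h1, h2⟩ := ((h N).and (Filter.eventually_ge_atTop N)).exists
  refine ⟨m, h2, fun i hi => ?_⟩
  have := h1 i (by exact_mod_cast hi)
  rwa [LaurentSeries.coeff_coe_powerSeries, LaurentSeries.coeff_coe_powerSeries] at this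

/-- The ring of power series is complete. -/
theorem exists_limit {x : ℕ → PowerSeries 𝔽} (h : ∀ m, (X : PowerSeries 𝔽) ^ m ∣ x (m + 1) - x m) :
    ∃ F : PowerSeries 𝔽, ∀ m, (X : PowerSeries 𝔽) ^ m ∣ F - x m := by
  have hst : ∀ i m, i < m → (x m).coeff i = (x (i + 1)).coeff i := by
    intro i m hm
    induction m, hm using Nat.le_induction with
    | base => rfl
    | succ m hm ih =>
      have := X_pow_dvd_iff.1 (h m) i hm
      rw [map_sub, sub_eq_zero] at this
      rw [this, ih]
  refine ⟨PowerSeries.mk fun i => (x (i + 1)).coeff i, fun m => X_pow_dvd_iff.2 fun i hi => ?_⟩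
  rw [map_sub, coeff_mk, hst i m hi, sub_self]

theorem coe_powerSeries_inv {f : PowerSeries 𝔽} (hf : constantCoeff f ≠ 0) :
    ((f⁻¹ : PowerSeries 𝔽) : LaurentSeries 𝔽) = (f : LaurentSeries 𝔽)⁻¹ := by
  refine (inv_eq_of_mul_eq_one_left ?_).symm
  rw [← PowerSeries.coe_mul, PowerSeries.inv_mul_cancel _ hf, map_one]

namespace HFraction

variable (H : HFraction 𝔽)

/-- The value of the finite continued fraction formed by the steps `i, …, i + m - 1` of `H`, as a
power series. -/
noncomputable def conv : ℕ → ℕ → PowerSeries 𝔽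
  | _, 0 => 0
  | i, m + 1 => C (H.v i) * X ^ H.k i *
      (1 + X * (H.u i : PowerSeries 𝔽) - X ^ (H.k i + 2) * conv (i + 1) m)⁻¹

theorem isHStep_conv (i m : ℕ) :
    IsHStep (H.conv i (m + 1)) (H.conv (i + 1) m) (H.k i) (H.v i) := by
  refine ⟨H.v_ne_zero i, H.u i, H.natDegree_u_le i, ?_⟩
  rw [conv, mul_assoc, PowerSeries.inv_mul_cancel _ (by simp), mul_one]

theorem cfracValue_tail (m : ℕ) : ∀ (i : ℕ) (α β : ℕ → LaurentSeries 𝔽),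
    (∀ t, α t = ((H.num (t + i + 1) : PowerSeries 𝔽) : LaurentSeries 𝔽)) →
    (∀ t, β t = ((H.den (t + i + 1) : PowerSeries 𝔽) : LaurentSeries 𝔽)) →
    cfracValue α β m =
      ((-(X ^ (H.k i + 2) * H.conv (i + 1) m) : PowerSeries 𝔽) : LaurentSeries 𝔽) := by
  induction m with
  | zero => intro i α β _ _; simp [cfracValue, conv]
  | succ m ih =>
    intro i α β hα hβ
    rw [cfracValue, ih (i + 1) _ _ (fun t => by rw [hα]; congr 3; ring)
      (fun t => by rw [hβ]; congr 3; ring), hα, hβ, ← map_add, div_eq_mul_inv,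
      ← coe_powerSeries_inv, ← PowerSeries.coe_mul]
    · congr 1
      rw [conv]
      simp only [zero_add, num, den, Polynomial.coe_monomial, Polynomial.coe_add,
        Polynomial.coe_mul, Polynomial.coe_one, Polynomial.coe_X, ← sub_eq_add_neg]
      rw [PowerSeries.monomial_eq_C_mul_X_pow, map_neg]
      ring
    · simp [den]

theorem cfracValue_eq_conv (m : ℕ) :
    cfracValue (fun i => ((H.num i : PowerSeries 𝔽) : LaurentSeries 𝔽))
      (fun i => ((H.den i : PowerSeries 𝔽) : LaurentSeries 𝔽)) m =
      (H.conv 0 m : LaurentSeries 𝔽) := by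
  cases m with
  | zero => simp [cfracValue, conv]
  | succ m =>
    rw [cfracValue, H.cfracValue_tail m 0 _ _ (fun t => rfl) (fun t => rfl), ← map_add,
      div_eq_mul_inv, ← coe_powerSeries_inv, ← PowerSeries.coe_mul]
    · congr 1
      rw [conv]
      simp only [num, den, Polynomial.coe_monomial, Polynomial.coe_add,
        Polynomial.coe_mul, Polynomial.coe_one, Polynomial.coe_X, ← sub_eq_add_neg]
      rw [PowerSeries.monomial_eq_C_mul_X_pow]
    · simp [den]

theorem isExpansionOf_iff {F : PowerSeries 𝔽} : H.IsExpansionOf F ↔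
    LaurentTendsto (fun m => (H.conv 0 m : LaurentSeries 𝔽)) (F : LaurentSeries 𝔽) := by
  rw [IsExpansionOf, show cfracValue _ _ = _ from funext H.cfracValue_eq_conv]

theorem s_strictMono : StrictMono H.s := hPos_strictMono H.k

/-- The nonzero Hankel determinants of a power series sit exactly at the positions `s_p` of any of
its `H`-fraction expansions: each determinant only sees finitely many coefficients, hence is a
determinant of a convergent. -/
theorem IsExpansionOf.hankel_ne_zero_iff {H : HFraction 𝔽} {F : PowerSeries 𝔽}
    (hH : H.IsExpansionOf F) (j : ℕ) : hankel F j ≠ 0 ↔ ∃ q, j = H.s q := by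
  obtain ⟨m, hm, hc⟩ := (H.isExpansionOf_iff.1 hH).exists_coeff_eq (2 * j)
  have hj : j ≤ hPos H.k m := by unfold hPos; omega
  have hstep : ∀ i < m, IsHStep (H.conv i (m - i)) (H.conv (i + 1) (m - (i + 1)))
      (H.k i) (H.v i) := fun i hi => by
    rw [show m - i = m - (i + 1) + 1 by omega]
    exact H.isHStep_conv i _
  have key := hankel_chain_ne_zero_iff (F := fun i => H.conv i (m - i)) hstep hj
  rw [show hankel F j = hankel (H.conv 0 (m - 0)) j from
    hankelDet_congr fun i hi => (hc i hi).symm, key]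
  constructor
  · rintro ⟨q, _, h⟩
    exact ⟨q, h⟩
  · rintro ⟨q, h⟩
    exact ⟨q, (hPos_strictMono H.k).le_iff_le.1 (h.symm.trans_le hj), h⟩

end HFraction

/-- The error of the convergents gains at least one order of vanishing at each step. -/
theorem HFraction.isExpansionOf_of_isHStep (H : HFraction 𝔽) (F : ℕ → PowerSeries 𝔽)
    (hF : ∀ i, F i * (1 + X * (H.u i : PowerSeries 𝔽) - X ^ (H.k i + 2) * F (i + 1)) =
      C (H.v i) * X ^ H.k i) : H.IsExpansionOf (F 0) := by
  rw [H.isExpansionOf_iff]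
  suffices h : ∀ m i, (X : PowerSeries 𝔽) ^ m ∣ H.conv i m - F i from
    laurentTendsto_coe fun m => h m 0
  intro m
  induction m with
  | zero => simp
  | succ m ih =>
    intro i
    obtain ⟨c, hc⟩ := ih (i + 1)
    set A := 1 + X * (H.u i : PowerSeries 𝔽) - X ^ (H.k i + 2) * F (i + 1) with hA
    set B := 1 + X * (H.u i : PowerSeries 𝔽) - X ^ (H.k i + 2) * H.conv (i + 1) m with hB
    have hA1 : A * A⁻¹ = 1 := PowerSeries.mul_inv_cancel _ (by simp [hA])
    have hB1 : B * B⁻¹ = 1 := PowerSeries.mul_inv_cancel _ (by simp [hB])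
    have hFi : F i = C (H.v i) * X ^ H.k i * A⁻¹ := by
      rw [← hF i, mul_assoc, hA1, mul_one]
    have hdiff : A⁻¹ * B⁻¹ * (A - B) = B⁻¹ - A⁻¹ := by
      linear_combination B⁻¹ * hA1 - A⁻¹ * hB1
    have hAB : A - B = X ^ (H.k i + 2) * (X ^ m * c) := by
      rw [hA, hB, ← hc]
      ring
    refine ⟨C (H.v i) * X ^ H.k i * A⁻¹ * B⁻¹ * X ^ (H.k i + 1) * c, ?_⟩
    rw [HFraction.conv, ← hB, hFi, ← mul_sub, ← hdiff, hAB]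
    ring

/-- A set of power series which is stable under the division step consists of series that have an
`H`-fraction expansion. -/
theorem exists_isExpansionOf (S : Set (PowerSeries 𝔽))
    (hS : ∀ F ∈ S, ∃ F' ∈ S, ∃ k v, IsHStep F F' k v) {F : PowerSeries 𝔽} (hF : F ∈ S) :
    ∃ H : HFraction 𝔽, H.IsExpansionOf F := by
  choose! f hfS k v hstep using hS
  choose! hv u hu hrel using hstep
  have hmem : ∀ i, f^[i] F ∈ S := fun i => by
    induction i with
    | zero => exact hF
    | succ i ih => rw [Function.iterate_succ_apply']; exact hfS _ ih
  let H : HFraction 𝔽 :=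
    { k := fun i => k (f^[i] F)
      v := fun i => v (f^[i] F)
      u := fun i => u (f^[i] F)
      v_ne_zero := fun i => hv _ (hmem i)
      natDegree_u_le := fun i => hu _ (hmem i) }
  refine ⟨H, H.isExpansionOf_of_isHStep (fun i => f^[i] F) fun i => ?_⟩
  rw [Function.iterate_succ_apply']
  exact hrel _ (hmem i)

end Convergence

/-! ### The auxiliary quadratic series and the complete quotients -/

section Quotients

open PowerSeries

/-- `[m]_q = 1 + q + ⋯ + q^{m-1}` as a power series. -/
noncomputable def geom (m : ℕ) : PowerSeries ℚ := ∑ i ∈ Finset.range m, X ^ i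

/-- `[m]_q` as a polynomial. -/
noncomputable def geomPoly (m : ℕ) : Polynomial ℚ := ∑ i ∈ Finset.range m, Polynomial.X ^ i

theorem coe_geomPoly (m : ℕ) : (geomPoly m : PowerSeries ℚ) = geom m := by
  induction m with
  | zero => simp [geomPoly, geom]
  | succ m ih =>
    simp only [geomPoly, geom, Finset.sum_range_succ, Polynomial.coe_add] at ih ⊢
    rw [ih, Polynomial.coe_pow, Polynomial.coe_X]

theorem natDegree_geomPoly_le (m : ℕ) : (geomPoly (m + 1)).natDegree ≤ m :=
  Polynomial.natDegree_sum_le_of_forall_le _ _ fun i hi => by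
    rw [Polynomial.natDegree_X_pow]
    have := Finset.mem_range.1 hi
    omega

theorem natDegree_geomPoly_le' (m : ℕ) : (geomPoly m).natDegree ≤ m := by
  cases m with
  | zero => simp [geomPoly]
  | succ m => exact (natDegree_geomPoly_le m).trans (by omega)

theorem geom_zero : geom 0 = 0 := by simp [geom]

theorem geom_succ (m : ℕ) : geom (m + 1) = geom m + X ^ m := by
  simp [geom, Finset.sum_range_succ]

theorem geom_succ' (m : ℕ) : geom (m + 1) = 1 + X * geom m := by
  simp [geom, Finset.sum_range_succ', Finset.mul_sum, pow_succ', add_comm]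

theorem one_sub_X_mul_geom (m : ℕ) : (1 - X) * geom m = 1 - X ^ m := by
  induction m with
  | zero => simp [geom_zero]
  | succ m ih => rw [geom_succ]; linear_combination ih

theorem geom_add (a b : ℕ) : geom (a + b) = geom a + X ^ a * geom b := by
  induction b with
  | zero => simp [geom_zero]
  | succ b ih => rw [← add_assoc, geom_succ, geom_succ, ih]; ring

theorem constantCoeff_geom_succ (m : ℕ) : constantCoeff (geom (m + 1)) = 1 := by
  rw [geom_succ']; simp

/-- The auxiliary quadratic equation `q^n (1 - q + q²) G² + (1 - q + q²) [n]_q G = 1`. -/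
def IsAuxSeries (n : ℕ) (G : PowerSeries ℚ) : Prop :=
  X ^ n * (1 - X + X ^ 2) * G ^ 2 + (1 - X + X ^ 2) * geom n * G = 1

theorem eq_zero_of_forall_X_pow_dvd {f : PowerSeries ℚ} (h : ∀ m, (X : PowerSeries ℚ) ^ m ∣ f) :
    f = 0 := by
  ext i
  exact X_pow_dvd_iff.1 (h (i + 1)) i (Nat.lt_succ_self i)

/-- The auxiliary series is the limit of the iteration `G ↦ 1 / ((1 - q + q²) ([n]_q + q^n G))`. -/
theorem exists_isAuxSeries {n : ℕ} (hn : 1 ≤ n) : ∃ G, IsAuxSeries n G := by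
  obtain ⟨n, rfl⟩ : ∃ a, n = a + 1 := ⟨n - 1, by omega⟩
  set D : PowerSeries ℚ → PowerSeries ℚ :=
    fun g => (1 - X + X ^ 2) * (geom (n + 1) + X ^ (n + 1) * g) with hD
  have hD1 : ∀ g, D g * (D g)⁻¹ = 1 := fun g =>
    PowerSeries.mul_inv_cancel _ (by simp [hD, constantCoeff_geom_succ])
  set x : ℕ → PowerSeries ℚ := fun m => (fun g => (D g)⁻¹)^[m] 0 with hx
  have hx1 : ∀ m, x (m + 1) = (D (x m))⁻¹ := fun m => Function.iterate_succ_apply' _ _ _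
  have hdiff : ∀ m, (X : PowerSeries ℚ) ^ m ∣ x (m + 1) - x m := by
    intro m
    induction m with
    | zero => simp
    | succ m ih =>
      obtain ⟨c, hc⟩ := ih
      refine ⟨-((D (x m))⁻¹ * (D (x (m + 1)))⁻¹ * (1 - X + X ^ 2) * X ^ n * c), ?_⟩
      have h1 := hD1 (x m)
      have h2 := hD1 (x (m + 1))
      have h3 : D (x (m + 1)) - D (x m) = (1 - X + X ^ 2) * X ^ (n + 1) * (X ^ m * c) := by
        rw [← hc, hD]; ring
      rw [hx1 (m + 1), hx1 m]
      rw [hx1 m] at h2 h3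
      linear_combination (-(D (x m))⁻¹ * (D (D (x m))⁻¹)⁻¹) * h3 -
        (D (D (x m))⁻¹)⁻¹ * h1 + (D (x m))⁻¹ * h2
  obtain ⟨G, hG⟩ := exists_limit hdiff
  refine ⟨G, sub_eq_zero.1 (eq_zero_of_forall_X_pow_dvd fun m => ?_)⟩
  obtain ⟨a, ha⟩ := hG m
  obtain ⟨b, hb⟩ := hG (m + 1)
  have h1 := hD1 (x m)
  rw [← hx1] at h1
  refine ⟨D G * X * b + x (m + 1) * (1 - X + X ^ 2) * X ^ (n + 1) * a, ?_⟩
  have e1 : X ^ (n + 1) * (1 - X + X ^ 2) * G ^ 2 + (1 - X + X ^ 2) * geom (n + 1) * G =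
      D G * G := by
    rw [hD]; ring
  have e2 : D G - D (x m) = (1 - X + X ^ 2) * X ^ (n + 1) * (X ^ m * a) := by
    rw [← ha, hD]; ring
  rw [e1]
  linear_combination D G * hb + x (m + 1) * e2 + h1

/-- `[m]_q + q^{m+1} + q^m (1 - q + q²) G`. For `m = n - 1` this is the `q`-metallic number, and up
to sign it is a complete quotient of it for every smaller `m`. -/
noncomputable def quotE (G : PowerSeries ℚ) (m : ℕ) : PowerSeries ℚ :=
  geom m + X ^ (m + 1) + X ^ m * (1 - X + X ^ 2) * G

/-- `[m]_q + q^n G`. -/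
noncomputable def quotU (n : ℕ) (G : PowerSeries ℚ) (m : ℕ) : PowerSeries ℚ :=
  geom m + X ^ n * G

/-- `[m+1]_q - q + q^n (1 - q + q²) G`, which is `1 + q² + ⋯ + q^m + q^n (1 - q + q²) G` for
`m ≥ 1`. -/
noncomputable def quotW (n : ℕ) (G : PowerSeries ℚ) (m : ℕ) : PowerSeries ℚ :=
  geom (m + 1) - X + X ^ n * (1 - X + X ^ 2) * G

/-- The complete quotient of index `3n + 1`. -/
noncomputable def quotF (n : ℕ) (G : PowerSeries ℚ) : PowerSeries ℚ :=
  (1 + X ^ n * (quotW n G (n - 1))⁻¹)⁻¹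

/-- Up to sign and a power of `q`, the complete quotient of index `3n`. -/
noncomputable def quotM (n : ℕ) (G : PowerSeries ℚ) : PowerSeries ℚ :=
  (geom n - X + 2 * X ^ n - X ^ (n + 1) * quotF n G)⁻¹

/-- Up to sign and a power of `q`, the central complete quotient, of index `3n - 1`. -/
noncomputable def quotJ (n : ℕ) (G : PowerSeries ℚ) : PowerSeries ℚ :=
  (geom n - X + 2 * X ^ n - X ^ (n + 1) + X ^ (2 * n + 1) * quotM n G)⁻¹

theorem quotU_mul_inv {n m : ℕ} (hn : 1 ≤ n) (hm : 1 ≤ m) (G : PowerSeries ℚ) :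
    quotU n G m * (quotU n G m)⁻¹ = 1 := by
  obtain ⟨m, rfl⟩ : ∃ a, m = a + 1 := ⟨m - 1, by omega⟩
  refine PowerSeries.mul_inv_cancel _ ?_
  simp [quotU, constantCoeff_geom_succ, show n ≠ 0 by omega]

theorem quotW_mul_inv {n : ℕ} (hn : 1 ≤ n) (m : ℕ) (G : PowerSeries ℚ) :
    quotW n G m * (quotW n G m)⁻¹ = 1 := by
  refine PowerSeries.mul_inv_cancel _ ?_
  simp [quotW, constantCoeff_geom_succ, show n ≠ 0 by omega]

theorem quotF_mul {n : ℕ} (hn : 1 ≤ n) (G : PowerSeries ℚ) :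
    quotF n G * (1 + X ^ n * (quotW n G (n - 1))⁻¹) = 1 :=
  PowerSeries.inv_mul_cancel _ (by simp [show n ≠ 0 by omega])

theorem quotM_mul {n : ℕ} (hn : 1 ≤ n) (G : PowerSeries ℚ) :
    quotM n G * (geom n - X + 2 * X ^ n - X ^ (n + 1) * quotF n G) = 1 := by
  obtain ⟨n, rfl⟩ : ∃ a, n = a + 1 := ⟨n - 1, by omega⟩
  exact PowerSeries.inv_mul_cancel _ (by simp [constantCoeff_geom_succ])

theorem quotJ_mul {n : ℕ} (hn : 1 ≤ n) (G : PowerSeries ℚ) :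
    quotJ n G * (geom n - X + 2 * X ^ n - X ^ (n + 1) + X ^ (2 * n + 1) * quotM n G) = 1 := by
  obtain ⟨n, rfl⟩ : ∃ a, n = a + 1 := ⟨n - 1, by omega⟩
  exact PowerSeries.inv_mul_cancel _ (by simp [constantCoeff_geom_succ])

variable {n : ℕ} {G : PowerSeries ℚ}

/-- In terms of fractions: `1 / E_m = 1 - q + q^{m+1} / U_{m+1}`. -/
theorem quotE_mul (hG : IsAuxSeries n G) (m : ℕ) :
    quotE G m * ((1 - X) * quotU n G (m + 1) + X ^ (m + 1)) = quotU n G (m + 1) := by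
  have hN := one_sub_X_mul_geom n
  have hS := one_sub_X_mul_geom m
  unfold IsAuxSeries at hG
  simp only [quotE, quotU, geom_succ, pow_succ]
  linear_combination (geom m + X ^ m * X + X ^ m * (1 - X + X ^ 2) * G + X ^ n * G) * hS +
    X ^ m * (1 - X) * hG - X ^ m * (1 - X + X ^ 2) * G * hN

theorem isHStep_quotE (hn : 1 ≤ n) (hG : IsAuxSeries n G) (m : ℕ) :
    IsHStep (quotE G (m + 1)) (-(X ^ m * (quotU n G (m + 2))⁻¹)) 0 1 := by
  refine ⟨one_ne_zero, -1, by simp, ?_⟩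
  have h1 := quotE_mul hG (m + 1)
  have h2 := quotU_mul_inv (m := m + 2) hn (by omega) G
  simp only [Polynomial.coe_neg, Polynomial.coe_one, map_one, pow_zero]
  linear_combination (quotU n G (m + 2))⁻¹ * h1 + (1 - quotE G (m + 1) * (1 - X)) * h2

theorem isHStep_quotU (hn : 1 ≤ n) {m p : ℕ} (hmp : n = m + p + 2) :
    IsHStep (-(X ^ m * (quotU n G (m + 2))⁻¹)) (-(X ^ p * G)) m (-1) := by
  refine ⟨by norm_num, geomPoly (m + 1), natDegree_geomPoly_le m, ?_⟩
  have h2 := quotU_mul_inv (m := m + 2) hn (by omega) G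
  have h3 : 1 + X * geom (m + 1) - X ^ (m + 2) * -(X ^ p * G) = quotU n G (m + 2) := by
    rw [quotU, geom_succ' (m + 1), hmp]; ring
  rw [coe_geomPoly, h3, map_neg, map_one]
  linear_combination -X ^ m * h2

theorem isHStep_quotG (hG : IsAuxSeries n G) {m p : ℕ} (hmp : n = m + p + 2) :
    IsHStep (-(X ^ p * G)) (-(quotE G m)) p (-1) := by
  refine ⟨by norm_num, geomPoly (p + 1) - 1, ?_, ?_⟩
  · exact (Polynomial.natDegree_sub_le _ _).trans (by simpa using natDegree_geomPoly_le p)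
  · have hN := one_sub_X_mul_geom n
    have h1 : geom n = 1 + X * geom (p + 1) + X ^ (p + 2) * geom m := by
      rw [← geom_succ', ← geom_add]; congr 1; omega
    have h2 : (X : PowerSeries ℚ) ^ n = X ^ (p + 2) * X ^ m := by rw [← pow_add]; congr 1; omega
    unfold IsAuxSeries at hG
    simp only [Polynomial.coe_sub, Polynomial.coe_one, coe_geomPoly, map_neg, map_one, quotE]
    linear_combination -X ^ p * hG + X ^ p * G * h1 - X ^ (p + 1) * G * hN +
      X ^ p * G * ((1 - X + X ^ 2) * G + X) * h2

theorem isHStep_quotE_zero (hG : IsAuxSeries (n + 1) G) :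
    IsHStep (quotE G 0) (X ^ n * G * (quotU (n + 1) G 1)⁻¹) 0 1 := by
  refine ⟨one_ne_zero, 0, by simp, ?_⟩
  have h1 := quotE_mul hG 0
  have h2 := quotU_mul_inv (n := n + 1) (m := 1) (by omega) le_rfl G
  have h3 : quotU (n + 1) G 1 = 1 + X ^ (n + 1) * G := by simp [quotU, geom]
  simp only [Polynomial.coe_zero, map_one, pow_zero]
  simp only [zero_add] at h1
  linear_combination (quotU (n + 1) G 1)⁻¹ * h1 + (1 - quotE G 0 * (1 - X)) * h2 +
    quotE G 0 * X * ((quotU (n + 1) G 1)⁻¹ * h3 - h2)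

/-- The closed form `q^{n+1} J = (1 - q + q²) G - (1 - q)` of the central complete quotient. -/
theorem X_pow_mul_quotJ (hn : 1 ≤ n) (hG : IsAuxSeries n G) :
    X ^ (n + 1) * quotJ n G = (1 - X + X ^ 2) * G - 1 + X := by
  have hQ : (X : PowerSeries ℚ) ^ n = 1 - (1 - X) * geom n := by
    rw [one_sub_X_mul_geom]; ring
  have hF := quotF_mul hn G
  have hW := quotW_mul_inv hn (n - 1) G
  have hWe : quotW n G (n - 1) = geom n - X + X ^ n * (1 - X + X ^ 2) * G := by
    rw [quotW, Nat.sub_add_cancel hn]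
  set W := quotW n G (n - 1)
  have hFW : quotF n G * (W + X ^ n) = W := by
    linear_combination W * hF - quotF n G * X ^ n * hW
  -- `Z` clears the denominators of `quotF` and `quotM`
  set Z := (geom n - X + 2 * X ^ n) * (W + X ^ n) - X ^ (n + 1) * W with hZ
  have hMZ : quotM n G * Z = W + X ^ n := by
    rw [hZ]
    linear_combination (W + X ^ n) * quotM_mul hn G + quotM n G * X ^ (n + 1) * hFW
  have hZ0 : Z ≠ 0 := by
    obtain ⟨n, rfl⟩ : ∃ a, n = a + 1 := ⟨n - 1, by omega⟩
    intro h
    have := congrArg constantCoeff h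
    rw [hZ, hWe] at this
    simp [constantCoeff_geom_succ] at this
  have key : ((1 - X + X ^ 2) * G - 1 + X) *
      ((geom n - X + 2 * X ^ n - X ^ (n + 1)) * Z + X ^ (2 * n + 1) * (W + X ^ n)) =
      X ^ (n + 1) * Z := by
    unfold IsAuxSeries at hG
    rw [hZ, hWe]
    simp only [pow_succ X n, pow_succ X (2 * n), pow_mul' X 2 n, hQ] at hG ⊢
    linear_combination (1 - X + X ^ 2) * ((geom n - X + 2 * (1 - (1 - X) * geom n) -
      X * (1 - (1 - X) * geom n)) ^ 2 + X * (1 - (1 - X) * geom n) ^ 2) * hG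
  have hcl : ((1 - X + X ^ 2) * G - 1 + X) *
      (geom n - X + 2 * X ^ n - X ^ (n + 1) + X ^ (2 * n + 1) * quotM n G) = X ^ (n + 1) := by
    apply mul_right_cancel₀ hZ0
    linear_combination key + ((1 - X + X ^ 2) * G - 1 + X) * X ^ (2 * n + 1) * hMZ
  rw [← hcl, mul_assoc, mul_comm _ (quotJ n G), quotJ_mul hn, mul_one]

theorem natDegree_centralPoly_le (n : ℕ) :
    (geomPoly n - 1 + Polynomial.C 2 * Polynomial.X ^ n : Polynomial ℚ).natDegree ≤ n := by
  refine (Polynomial.natDegree_add_le _ _).trans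
    (max_le ?_ (Polynomial.natDegree_C_mul_X_pow_le _ _))
  exact (Polynomial.natDegree_sub_le _ _).trans (by simpa using natDegree_geomPoly_le' n)

theorem coe_centralPoly (n : ℕ) :
    1 + X * ((geomPoly n - 1 + Polynomial.C 2 * Polynomial.X ^ n : Polynomial ℚ) : PowerSeries ℚ) =
      geom (n + 1) - X + 2 * X ^ (n + 1) := by
  simp only [Polynomial.coe_add, Polynomial.coe_sub, Polynomial.coe_mul, Polynomial.coe_pow,
    Polynomial.coe_X, Polynomial.coe_one, coe_geomPoly, geom_succ', Polynomial.coe_C]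
  rw [map_ofNat C]
  ring

theorem isHStep_central_left (hG : IsAuxSeries (n + 1) G) :
    IsHStep (X ^ n * G * (quotU (n + 1) G 1)⁻¹) (-(X ^ (n + 1) * quotJ (n + 1) G)) n 1 := by
  refine ⟨one_ne_zero, _, natDegree_centralPoly_le n, ?_⟩
  have h2 := quotU_mul_inv (n := n + 1) (m := 1) (by omega) le_rfl G
  have h3 : quotU (n + 1) G 1 = 1 + X ^ (n + 1) * G := by simp [quotU, geom]
  have hJ := X_pow_mul_quotJ (by omega) hG
  have hN := one_sub_X_mul_geom (n + 1)
  unfold IsAuxSeries at hG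
  rw [coe_centralPoly, map_one]
  have h4 : G * (geom (n + 1) - X + 2 * X ^ (n + 1) -
      X ^ (n + 2) * -(X ^ (n + 1) * quotJ (n + 1) G)) = quotU (n + 1) G 1 := by
    rw [h3]
    linear_combination hG + G * X ^ (n + 1) * hJ + X * G * hN
  linear_combination X ^ n * (quotU (n + 1) G 1)⁻¹ * h4 + X ^ n * h2

theorem isHStep_central (n : ℕ) (G : PowerSeries ℚ) :
    IsHStep (-(X ^ (n + 1) * quotJ (n + 1) G)) (-(X ^ n * quotM (n + 1) G)) (n + 1) (-1) := by
  refine ⟨by norm_num, geomPoly n - 1 + Polynomial.C 2 * Polynomial.X ^ n - Polynomial.X ^ (n + 1),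
    ?_, ?_⟩
  · refine (Polynomial.natDegree_sub_le _ _).trans (max_le ?_ (by simp))
    exact (natDegree_centralPoly_le n).trans (by omega)
  · have hJ := quotJ_mul (n := n + 1) (by omega) G
    have h := coe_centralPoly n
    rw [Polynomial.coe_sub, Polynomial.coe_pow, Polynomial.coe_X, map_neg, map_one]
    linear_combination -X ^ (n + 1) * hJ - X ^ (n + 1) * quotJ (n + 1) G * h

theorem isHStep_central_right (n : ℕ) (G : PowerSeries ℚ) :
    IsHStep (-(X ^ n * quotM (n + 1) G)) (quotF (n + 1) G) n (-1) := by
  refine ⟨by norm_num, _, natDegree_centralPoly_le n, ?_⟩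
  have hM := quotM_mul (n := n + 1) (by omega) G
  rw [coe_centralPoly, map_neg, map_one]
  linear_combination -X ^ n * hM

theorem isHStep_quotF (n : ℕ) (G : PowerSeries ℚ) :
    IsHStep (quotF (n + 2) G) (-(X ^ n * (quotW (n + 2) G (n + 1))⁻¹)) 0 1 := by
  refine ⟨one_ne_zero, 0, by simp, ?_⟩
  have hF := quotF_mul (n := n + 2) (by omega) G
  rw [show n + 2 - 1 = n + 1 by omega] at hF
  simp only [Polynomial.coe_zero, map_one, pow_zero]
  linear_combination hF

/-- For `n = 1` the complete quotient of index `3n + 1` continues differently. -/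
theorem isHStep_quotF_one (G : PowerSeries ℚ) :
    IsHStep (quotF 1 G) ((quotW 1 G 0)⁻¹ * ((1 - X + X ^ 2) * G - 1)) 0 1 := by
  refine ⟨one_ne_zero, 1, by simp, ?_⟩
  have hF := quotF_mul le_rfl G
  have hW := quotW_mul_inv le_rfl 0 G
  have hWe : quotW 1 G 0 = 1 - X + X * (1 - X + X ^ 2) * G := by simp [quotW, geom]
  rw [Nat.sub_self] at hF
  simp only [Polynomial.coe_one, map_one, pow_zero]
  linear_combination hF - quotF 1 G * X * (hW - (quotW 1 G 0)⁻¹ * hWe)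

theorem isHStep_quotW (hn : 1 ≤ n) {m r : ℕ} (hmr : n = m + r + 2) :
    IsHStep (-(X ^ m * (quotW n G (m + 1))⁻¹)) (-(X ^ r * ((1 - X + X ^ 2) * G))) m (-1) := by
  refine ⟨by norm_num, geomPoly (m + 1) - 1, ?_, ?_⟩
  · exact (Polynomial.natDegree_sub_le _ _).trans (by simpa using natDegree_geomPoly_le m)
  · have h2 := quotW_mul_inv hn (m + 1) G
    have h3 : 1 + X * (geom (m + 1) - 1) - X ^ (m + 2) * -(X ^ r * ((1 - X + X ^ 2) * G)) =
        quotW n G (m + 1) := by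
      rw [quotW, geom_succ' (m + 1), hmr]; ring
    rw [Polynomial.coe_sub, Polynomial.coe_one, coe_geomPoly, h3, map_neg, map_one]
    linear_combination -X ^ m * h2

theorem isHStep_quotTG (hG : IsAuxSeries n G) {m r : ℕ} (hmr : n = m + r + 2) :
    IsHStep (-(X ^ r * ((1 - X + X ^ 2) * G))) (-(geom m + X ^ m * G)) r (-1) := by
  refine ⟨by norm_num, geomPoly (r + 1), natDegree_geomPoly_le r, ?_⟩
  have h1 : geom n = 1 + X * geom (r + 1) + X ^ (r + 2) * geom m := by
    rw [← geom_succ', ← geom_add]; congr 1; omega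
  have h2 : (X : PowerSeries ℚ) ^ n = X ^ (r + 2) * X ^ m := by rw [← pow_add]; congr 1; omega
  unfold IsAuxSeries at hG
  simp only [coe_geomPoly, map_neg, map_one]
  linear_combination -X ^ r * hG + X ^ r * (1 - X + X ^ 2) * G * h1 +
    X ^ r * (1 - X + X ^ 2) * G ^ 2 * h2

theorem isHStep_quotGeom (hn : 1 ≤ n) (hG : IsAuxSeries n G) (m : ℕ) :
    IsHStep (-(geom (m + 1) + X ^ (m + 1) * G)) (-(X ^ m * (quotW n G (m + 1))⁻¹)) 0 (-1) := by
  refine ⟨by norm_num, -1, by simp, ?_⟩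
  have h2 := quotW_mul_inv hn (m + 1) G
  have h1 : (geom (m + 1) + X ^ (m + 1) * G) * ((1 - X) * quotW n G (m + 1) + X ^ (m + 2)) =
      quotW n G (m + 1) := by
    have hN := one_sub_X_mul_geom n
    have hS := one_sub_X_mul_geom (m + 1)
    unfold IsAuxSeries at hG
    simp only [quotW, geom_succ (m + 1), pow_succ X (m + 1)]
    linear_combination (geom (m + 1) + X ^ (m + 1) * G + X ^ n * (1 - X + X ^ 2) * G - X) * hS +
      X ^ (m + 1) * (1 - X) * hG - X ^ (m + 1) * (1 - X + X ^ 2) * G * hN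
  simp only [Polynomial.coe_neg, Polynomial.coe_one, map_neg, map_one, pow_zero]
  linear_combination -(quotW n G (m + 1))⁻¹ * h1 -
    (1 - (geom (m + 1) + X ^ (m + 1) * G) * (1 - X)) * h2

end Quotients

/-! ### The `q`-metallic number -/

section Metallic

open PowerSeries

variable {n : ℕ} {G : PowerSeries ℚ}

/-- `Φ (1 - q + q^n (1 - q + q²) G) = 1` for `Φ = quotE G (n - 1)`. -/
theorem quotE_pred_mul (hn : 1 ≤ n) (hG : IsAuxSeries n G) :
    quotE G (n - 1) * (1 - X + X ^ n * (1 - X + X ^ 2) * G) = 1 := by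
  have h1 := quotE_mul hG (n - 1)
  have h2 := quotU_mul_inv hn hn G
  have h3 : (1 - X + X ^ 2) * G * quotU n G n = 1 := by
    unfold IsAuxSeries at hG
    rw [quotU]
    linear_combination hG
  rw [Nat.sub_add_cancel hn] at h1
  linear_combination (quotU n G n)⁻¹ * h1 + (1 - quotE G (n - 1) * (1 - X) -
    quotE G (n - 1) * X ^ n * (1 - X + X ^ 2) * G) * h2 +
    quotE G (n - 1) * X ^ n * (quotU n G n)⁻¹ * h3

theorem quotE_pred_quadratic (hn : 1 ≤ n) (hG : IsAuxSeries n G) :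
    quotE G (n - 1) * (X * geom n * quotE G (n - 1) + 1) =
      geom n * (X * geom n * quotE G (n - 1) + 1) + X ^ (2 * n) * quotE G (n - 1) := by
  have h := quotE_pred_mul hn hG
  have hN := one_sub_X_mul_geom n
  set Φ := quotE G (n - 1)
  set Ψ := 1 - X + X ^ n * (1 - X + X ^ 2) * G with hΨ
  have hquad : X * geom n + (1 - X * geom n ^ 2 - X ^ (2 * n)) * Ψ - geom n * Ψ ^ 2 = 0 := by
    have hQ : (X : PowerSeries ℚ) ^ n = 1 - (1 - X) * geom n := by rw [hN]; ring
    unfold IsAuxSeries at hG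
    rw [hΨ]
    simp only [pow_mul' X 2 n, hQ] at hG ⊢
    linear_combination -geom n * (1 - (1 - X) * geom n) * (1 - X + X ^ 2) * hG
  linear_combination Φ ^ 2 * hquad + ((1 - X * geom n ^ 2 - X ^ (2 * n)) * (-Φ) +
    geom n * (1 + Φ * Ψ)) * h

end Metallic

section Metallic

open PowerSeries

/-- The convergents of the continued fraction of the `q`-metallic number are power series: two
steps amount to `Y ↦ [n]_q + q^{2n} Y / (q [n]_q Y + 1)`. -/
noncomputable def metallicConv (n : ℕ) : ℕ → PowerSeries ℚ
  | 0 => geom n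
  | 1 => geom n + X ^ (2 * n - 1) * (geom n)⁻¹
  | m + 2 => geom n + X ^ (2 * n) * metallicConv n m * (X * geom n * metallicConv n m + 1)⁻¹

theorem constantCoeff_metallicConv {n : ℕ} (hn : 1 ≤ n) :
    ∀ m, constantCoeff (metallicConv n m) = 1
  | 0 => by
    obtain ⟨n, rfl⟩ : ∃ a, n = a + 1 := ⟨n - 1, by omega⟩
    exact constantCoeff_geom_succ n
  | 1 => by
    obtain ⟨n, rfl⟩ : ∃ a, n = a + 1 := ⟨n - 1, by omega⟩
    simp [metallicConv, constantCoeff_geom_succ, show 2 * (n + 1) - 1 ≠ 0 by omega]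
  | m + 2 => by
    obtain ⟨n, rfl⟩ : ∃ a, n = a + 1 := ⟨n - 1, by omega⟩
    simp [metallicConv, constantCoeff_geom_succ]

theorem qVar_eq_coe : qVar = ((X : PowerSeries ℚ) : LaurentSeries ℚ) :=
  PowerSeries.coe_X.symm

theorem qVar_ne_zero : qVar ≠ 0 := by
  simp [qVar]

theorem qInt_qVar (n : ℕ) : qInt qVar n = (geom n : LaurentSeries ℚ) := by
  simp only [qInt, geom, qVar_eq_coe, map_sum, map_pow]

theorem qInt_inv_succ {K : Type*} [Field K] {t : K} (ht : t ≠ 0) (n : ℕ) :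
    qInt t⁻¹ (n + 1) = qInt t (n + 1) / t ^ n := by
  rw [eq_div_iff (pow_ne_zero n ht), qInt, qInt, Finset.sum_mul, ← Finset.sum_range_reflect]
  refine Finset.sum_congr rfl fun i hi => ?_
  have hi' : i ≤ n := by simpa [Nat.lt_succ_iff] using hi
  rw [Nat.add_sub_cancel, inv_pow, inv_mul_eq_div, div_eq_iff (pow_ne_zero _ ht), ← pow_add]
  congr 1
  omega

theorem coe_ne_zero_of_constantCoeff {f : PowerSeries ℚ} (hf : constantCoeff f = 1) :
    (f : LaurentSeries ℚ) ≠ 0 := by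
  intro h
  have : f = 0 := HahnSeries.ofPowerSeries_injective (by rw [h, map_zero])
  rw [this] at hf
  simp at hf

theorem metallic_cfracValue {n : ℕ} (hn : 1 ≤ n) : ∀ m,
    qInt qVar n + cfracValue (metallicNum n) (metallicDen n) m =
      (metallicConv n m : LaurentSeries ℚ)
  | 0 => by simp [cfracValue, metallicConv, qInt_qVar]
  | 1 => by
    obtain ⟨n, rfl⟩ : ∃ a, n = a + 1 := ⟨n - 1, by omega⟩
    have hq := qVar_ne_zero
    have hc := constantCoeff_geom_succ n
    have hg := coe_ne_zero_of_constantCoeff hc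
    simp only [cfracValue, metallicNum, metallicDen, metallicConv, Even.zero, if_true, add_zero,
      qInt_inv_succ hq, qInt_qVar, map_add, PowerSeries.coe_mul, map_pow, ← qVar_eq_coe]
    rw [coe_powerSeries_inv (by rw [hc]; exact one_ne_zero),
      show 2 * (n + 1) - 1 = (n + 1) + n by omega]
    field_simp
    ring
  | m + 2 => by
    have ih := metallic_cfracValue hn m
    have hY := coe_ne_zero_of_constantCoeff (constantCoeff_metallicConv hn m)
    have hα : (fun i => metallicNum n (i + 1 + 1)) = metallicNum n := by
      funext i; simp [metallicNum, add_assoc, Nat.even_add]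
    have hβ : (fun i => metallicDen n (i + 1 + 1)) = metallicDen n := by
      funext i; simp [metallicDen, add_assoc, Nat.even_add]
    obtain ⟨n, rfl⟩ : ∃ a, n = a + 1 := ⟨n - 1, by omega⟩
    have hq := qVar_ne_zero
    have hc : constantCoeff (X * geom (n + 1) * metallicConv (n + 1) m + 1) = 1 := by simp
    have hD := coe_ne_zero_of_constantCoeff hc
    rw [cfracValue, cfracValue, hα, hβ, metallicConv]
    simp only [metallicNum, metallicDen, Even.zero, if_true, zero_add, Nat.not_even_one, if_false]
    rw [ih, qInt_inv_succ hq, qInt_qVar]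
    simp only [map_add, PowerSeries.coe_mul, map_pow, ← qVar_eq_coe]
    rw [coe_powerSeries_inv (by rw [hc]; exact one_ne_zero)]
    simp only [map_add, PowerSeries.coe_mul, map_one, ← qVar_eq_coe] at hD ⊢
    generalize (HahnSeries.ofPowerSeries ℤ ℚ) (metallicConv (n + 1) m) = Y at *
    generalize (HahnSeries.ofPowerSeries ℤ ℚ) (geom (n + 1)) = N at *
    congr 1
    have h1 : N / qVar ^ n + qVar⁻¹ ^ (n + 1) / Y =
        (qVar * N * Y + 1) / (qVar ^ (n + 1) * Y) := by
      rw [inv_pow, pow_succ]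
      field_simp
    rw [h1, div_div_eq_mul_div]
    ring

theorem isQMetallic_quotE {n : ℕ} {G : PowerSeries ℚ} (hn : 1 ≤ n) (hG : IsAuxSeries n G) :
    IsQMetallic n (quotE G (n - 1)) := by
  have hquad := quotE_pred_quadratic hn hG
  have hΦ := quotE_pred_mul hn hG
  rw [IsQMetallic, show (fun m => qInt qVar n + cfracValue (metallicNum n) (metallicDen n) m) = _
    from funext (metallic_cfracValue hn)]
  refine laurentTendsto_coe fun m => ?_
  set Φ := quotE G (n - 1)
  have hΦ0 : constantCoeff Φ = 1 := by
    have := congrArg constantCoeff hΦ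
    simpa [show n ≠ 0 by omega] using this
  have hD : ∀ f : PowerSeries ℚ, (X * geom n * f + 1) * (X * geom n * f + 1)⁻¹ = 1 := fun f =>
    PowerSeries.mul_inv_cancel _ (by simp)
  induction m using Nat.twoStepInduction with
  | zero => simp
  | one => rw [pow_one, X_dvd_iff, map_sub, hΦ0, constantCoeff_metallicConv hn, sub_self]
  | more m ih _ =>
    obtain ⟨c, hc⟩ := ih
    obtain ⟨a, ha⟩ : ∃ a, 2 * n = a + 2 := ⟨2 * n - 2, by omega⟩
    have h1 := hD (metallicConv n m)
    have h2 := hD Φ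
    rw [metallicConv]
    set y := metallicConv n m
    rw [ha] at hquad ⊢
    refine ⟨X ^ a * (X * geom n * y + 1)⁻¹ * (X * geom n * Φ + 1)⁻¹ * c, ?_⟩
    have hΦ2 : Φ = geom n + X ^ (a + 2) * Φ * (X * geom n * Φ + 1)⁻¹ := by
      linear_combination (X * geom n * Φ + 1)⁻¹ * hquad + (geom n - Φ) * h2
    have h3 : y * (X * geom n * y + 1)⁻¹ - Φ * (X * geom n * Φ + 1)⁻¹ =
        (X * geom n * y + 1)⁻¹ * (X * geom n * Φ + 1)⁻¹ * (y - Φ) := by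
      linear_combination Φ * (X * geom n * Φ + 1)⁻¹ * h1 - y * (X * geom n * y + 1)⁻¹ * h2
    rw [hc] at h3
    linear_combination X ^ (a + 2) * h3 - hΦ2

end Metallic

/-! ### The complete chain of quotients -/

section MetallicChain

open PowerSeries

/-- The sequence `f₀ 0, f₁ 0, f₂ 0, f₀ 1, f₁ 1, f₂ 1, …`. -/
def interleave {α : Type*} (f₀ f₁ f₂ : ℕ → α) (i : ℕ) : α :=
  if i % 3 = 0 then f₀ (i / 3) else if i % 3 = 1 then f₁ (i / 3) else f₂ (i / 3)

section Interleave

variable {α : Type*} (f₀ f₁ f₂ : ℕ → α) (p : ℕ)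

theorem interleave_zero : interleave f₀ f₁ f₂ (3 * p) = f₀ p := by
  rw [interleave, if_pos (by omega), show 3 * p / 3 = p by omega]

theorem interleave_one : interleave f₀ f₁ f₂ (3 * p + 1) = f₁ p := by
  rw [interleave, if_neg (by omega), if_pos (by omega), show (3 * p + 1) / 3 = p by omega]

theorem interleave_two : interleave f₀ f₁ f₂ (3 * p + 2) = f₂ p := by
  rw [interleave, if_neg (by omega), if_neg (by omega), show (3 * p + 2) / 3 = p by omega]

end Interleave

/-- The exponents `k_{3p}` of the `H`-fraction of the `q`-metallic number. -/
def metallicK₀ (n p : ℕ) : ℕ :=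
  if p < n then 0 else if p = n then n - 1 else p - n - 1

/-- The exponents `k_{3p+1}`. -/
def metallicK₁ (n p : ℕ) : ℕ :=
  if p + 1 < n then n - 2 - p else if p + 1 = n then n - 1 else 0

/-- The exponents `k_{3p+2}`. -/
def metallicK₂ (n p : ℕ) : ℕ :=
  if p + 1 < n then p else if p + 1 = n then n else 2 * n - 2 - p

/-- The exponents `k_i`, for `i ≤ 6n - 2`. -/
def metallicK (n : ℕ) : ℕ → ℕ :=
  interleave (metallicK₀ n) (metallicK₁ n) (metallicK₂ n)

/-- The coefficients `v_i`, for `i ≤ 6n - 2`: they are `-1` except for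
`v_0 = v_{3n-2} = v_{3n+1} = 1`. -/
def metallicV (n : ℕ) : ℕ → ℚ :=
  interleave (fun p => if p = 0 then 1 else -1)
    (fun p => if p + 1 = n ∨ p = n then 1 else -1) (fun _ => -1)

variable (n : ℕ) (G : PowerSeries ℚ)

/-- The complete quotients of index `3p`. -/
noncomputable def metallicF₀ (p : ℕ) : PowerSeries ℚ :=
  if p = 0 then quotE G (n - 1)
  else if p < n then -quotE G (n - 1 - p)
  else if p = n then -(X ^ (n - 1) * quotM n G)
  else -(X ^ (p - n - 1) * ((1 - X + X ^ 2) * G))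

/-- The complete quotients of index `3p + 1`. -/
noncomputable def metallicF₁ (p : ℕ) : PowerSeries ℚ :=
  if p + 1 < n then -(X ^ (n - 2 - p) * (quotU n G (n - p))⁻¹)
  else if p + 1 = n then X ^ (n - 1) * G * (quotU n G 1)⁻¹
  else if p = n then quotF n G
  else -(geom (2 * n - 1 - p) + X ^ (2 * n - 1 - p) * G)

/-- The complete quotients of index `3p + 2`. The last one, of index `6n - 1`, ends the chain; for
`n ≥ 2` it coincides with the complete quotient of index `3`, so the expansion is periodic. -/
noncomputable def metallicF₂ (p : ℕ) : PowerSeries ℚ :=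
  if p + 1 < n then -(X ^ p * G)
  else if p + 1 = n then -(X ^ n * quotJ n G)
  else if p + 1 < 2 * n then -(X ^ (2 * n - 2 - p) * (quotW n G (2 * n - 1 - p))⁻¹)
  else if n = 1 then (quotW 1 G 0)⁻¹ * ((1 - X + X ^ 2) * G - 1)
  else -quotE G (n - 2)

/-- The complete quotients of the `q`-metallic number. -/
noncomputable def metallicF : ℕ → PowerSeries ℚ :=
  interleave (metallicF₀ n G) (metallicF₁ n G) (metallicF₂ n G)

variable {n G}

theorem isHStep_metallic₀ (hn : 1 ≤ n) (hG : IsAuxSeries n G) {p : ℕ} (hp : p < 2 * n) :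
    IsHStep (metallicF₀ n G p) (metallicF₁ n G p) (metallicK₀ n p)
      (if p = 0 then 1 else -1) := by
  rcases lt_trichotomy p n with h | rfl | h
  · -- the first half, where the sign of `v_0` is exceptional
    have key : IsHStep (quotE G (n - 1 - p)) (metallicF₁ n G p) (metallicK₀ n p) 1 := by
      rw [metallicK₀, if_pos h]
      by_cases h' : p + 1 < n
      · rw [metallicF₁, if_pos h', show n - 1 - p = n - 2 - p + 1 by omega,
          show n - p = n - 2 - p + 2 by omega]
        exact isHStep_quotE hn hG _
      · obtain ⟨a, rfl⟩ : ∃ a, n = a + 1 := ⟨n - 1, by omega⟩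
        rw [metallicF₁, if_neg h', if_pos (by omega), show a + 1 - 1 - p = 0 by omega,
          Nat.add_sub_cancel]
        exact isHStep_quotE_zero hG
    by_cases h0 : p = 0
    · rw [if_pos h0]
      rw [metallicF₀, if_pos h0]
      simpa [h0] using key
    · rw [if_neg h0, metallicF₀, if_neg h0, if_pos h]
      exact key.neg
  · obtain ⟨a, rfl⟩ : ∃ a, p = a + 1 := ⟨p - 1, by omega⟩
    rw [metallicF₀, if_neg (by omega), if_neg (by omega), if_pos rfl, metallicF₁,
      if_neg (by omega), if_neg (by omega), if_pos rfl, metallicK₀, if_neg (by omega),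
      if_pos rfl, if_neg (by omega), Nat.add_sub_cancel]
    exact isHStep_central_right a G
  · rw [metallicF₀, if_neg (by omega), if_neg (by omega), if_neg (by omega), metallicF₁,
      if_neg (by omega), if_neg (by omega), if_neg (by omega), metallicK₀, if_neg (by omega),
      if_neg (by omega), if_neg (by omega)]
    exact isHStep_quotTG hG (by omega)

theorem isHStep_metallic₁ (hn : 1 ≤ n) (hG : IsAuxSeries n G) {p : ℕ} (hp : p < 2 * n) :
    IsHStep (metallicF₁ n G p) (metallicF₂ n G p) (metallicK₁ n p)
      (if p + 1 = n ∨ p = n then 1 else -1) := by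
  rcases lt_trichotomy (p + 1) n with h | rfl | h
  · rw [metallicF₁, if_pos h, metallicF₂, if_pos h, metallicK₁, if_pos h, if_neg (by omega),
      show n - p = n - 2 - p + 2 by omega]
    exact isHStep_quotU hn (by omega)
  · rw [metallicF₁, if_neg (by omega), if_pos rfl, metallicF₂, if_neg (by omega), if_pos rfl,
      metallicK₁, if_neg (by omega), if_pos rfl, if_pos (Or.inl rfl), Nat.add_sub_cancel]
    exact isHStep_central_left hG
  · have a1 : ¬ p + 1 < n := by omega
    have a2 : ¬ p + 1 = n := by omega
    simp only [metallicF₁, metallicF₂, metallicK₁, a1, a2, if_false, false_or]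
    by_cases h1 : p = n
    · subst h1
      rw [if_pos rfl, if_pos rfl]
      by_cases h2 : p = 1
      · subst h2
        rw [if_neg (by omega), if_pos rfl]
        exact isHStep_quotF_one G
      · obtain ⟨a, rfl⟩ : ∃ a, p = a + 2 := ⟨p - 2, by omega⟩
        rw [if_pos (by omega), show 2 * (a + 2) - 2 - (a + 2) = a by omega,
          show 2 * (a + 2) - 1 - (a + 2) = a + 1 by omega]
        exact isHStep_quotF a G
    · rw [if_neg h1, if_neg h1]
      by_cases h2 : p + 1 < 2 * n
      · rw [if_pos h2, show 2 * n - 1 - p = 2 * n - 2 - p + 1 by omega]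
        exact isHStep_quotGeom hn hG _
      · rw [if_neg h2, if_neg (by omega), show 2 * n - 1 - p = 0 by omega, geom_zero, zero_add]
        exact isHStep_quotG hG (by omega)

theorem isHStep_metallic₂ (hn : 1 ≤ n) (hG : IsAuxSeries n G) {p : ℕ} (hp : p + 1 < 2 * n) :
    IsHStep (metallicF₂ n G p) (metallicF₀ n G (p + 1)) (metallicK₂ n p) (-1) := by
  rw [metallicF₀, if_neg (by omega)]
  rcases lt_trichotomy (p + 1) n with h | rfl | h
  · rw [metallicF₂, if_pos h, if_pos h, metallicK₂, if_pos h]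
    exact isHStep_quotG hG (by omega)
  · rw [metallicF₂, if_neg (by omega), if_pos rfl, if_neg (by omega), if_pos rfl, metallicK₂,
      if_neg (by omega), if_pos rfl, Nat.add_sub_cancel]
    exact isHStep_central p G
  · rw [metallicF₂, if_neg (by omega), if_neg (by omega), if_pos hp, if_neg (by omega),
      if_neg (by omega), metallicK₂, if_neg (by omega), if_neg (by omega),
      show 2 * n - 1 - p = 2 * n - 2 - p + 1 by omega]
    exact isHStep_quotW hn (by omega)

theorem isHStep_metallic (hn : 1 ≤ n) (hG : IsAuxSeries n G) {i : ℕ} (hi : i < 6 * n - 1) :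
    IsHStep (metallicF n G i) (metallicF n G (i + 1)) (metallicK n i) (metallicV n i) := by
  obtain ⟨p, rfl | rfl | rfl⟩ : ∃ p, i = 3 * p ∨ i = 3 * p + 1 ∨ i = 3 * p + 2 :=
    ⟨i / 3, by omega⟩
  · simp only [metallicF, metallicK, metallicV, interleave_zero, interleave_one]
    exact isHStep_metallic₀ hn hG (by omega)
  · simp only [metallicF, metallicK, metallicV, interleave_one, interleave_two, add_assoc,
      Nat.reduceAdd]
    exact isHStep_metallic₁ hn hG (by omega)
  · rw [show 3 * p + 2 + 1 = 3 * (p + 1) by ring]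
    simp only [metallicF, metallicK, metallicV, interleave_two, interleave_zero]
    exact isHStep_metallic₂ hn hG (by omega)

theorem metallicF_zero : metallicF n G 0 = quotE G (n - 1) := by
  rw [metallicF, show (0 : ℕ) = 3 * 0 from rfl, interleave_zero, metallicF₀, if_pos rfl]

theorem metallicF_periodic (hn : 2 ≤ n) : metallicF n G (6 * n - 1) = metallicF n G 3 := by
  rw [metallicF, show 6 * n - 1 = 3 * (2 * n - 1) + 2 by omega, interleave_two,
    show 3 = 3 * 1 from rfl, interleave_zero, metallicF₂, if_neg (by omega), if_neg (by omega),
    if_neg (by omega), if_neg (by omega), metallicF₀, if_neg (by omega), if_pos (by omega),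
    Nat.sub_sub]

theorem exists_isExpansionOf_metallic (hn : 2 ≤ n) (hG : IsAuxSeries n G) :
    ∃ H : HFraction ℚ, H.IsExpansionOf (quotE G (n - 1)) := by
  refine exists_isExpansionOf {F | ∃ i < 6 * n - 1, F = metallicF n G i} ?_
    ⟨0, by omega, metallicF_zero.symm⟩
  rintro F ⟨i, hi, rfl⟩
  refine ⟨metallicF n G (i + 1), ?_, _, _, isHStep_metallic (by omega) hG hi⟩
  by_cases h : i + 1 < 6 * n - 1
  · exact ⟨i + 1, h, rfl⟩
  · refine ⟨3, by omega, ?_⟩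
    rw [← metallicF_periodic hn, show i + 1 = 6 * n - 1 by omega]

end MetallicChain

/-! ### Positions and signs -/

section Signs

variable {n : ℕ}

theorem metallicK_symm {i : ℕ} (hn : 1 ≤ n) (hi : i ≤ 6 * n - 2) :
    metallicK n (6 * n - 2 - i) = metallicK n i := by
  obtain ⟨p, rfl | rfl | rfl⟩ : ∃ p, i = 3 * p ∨ i = 3 * p + 1 ∨ i = 3 * p + 2 :=
    ⟨i / 3, by omega⟩
  · rw [show 6 * n - 2 - 3 * p = 3 * (2 * n - 1 - p) + 1 by omega]
    simp only [metallicK, interleave_zero, interleave_one, metallicK₀, metallicK₁]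
    split_ifs <;> omega
  · rw [show 6 * n - 2 - (3 * p + 1) = 3 * (2 * n - 1 - p) by omega]
    simp only [metallicK, interleave_zero, interleave_one, metallicK₀, metallicK₁]
    split_ifs <;> omega
  · rw [show 6 * n - 2 - (3 * p + 2) = 3 * (2 * n - 2 - p) + 2 by omega]
    simp only [metallicK, interleave_two, metallicK₂]
    split_ifs <;> omega

theorem hPos_metallicK_first {p : ℕ} (hp : p < n) : hPos (metallicK n) (3 * p) = p * (n + 1) := by
  induction p with
  | zero => simp [hPos_zero]
  | succ p ih =>
    rw [show 3 * (p + 1) = 3 * p + 1 + 1 + 1 by ring, hPos_succ, hPos_succ, hPos_succ,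
      ih (by omega)]
    simp only [metallicK, interleave_zero, interleave_one, interleave_two, add_assoc,
      metallicK₀, metallicK₁, metallicK₂]
    rw [if_pos (by omega), if_pos hp, if_pos hp, add_mul]
    omega

theorem hPos_metallicK_central (hn : 1 ≤ n) :
    hPos (metallicK n) (3 * n - 1) = n * (n + 1) ∧
      hPos (metallicK n) (3 * n) = n * (n + 1) + (n + 1) := by
  obtain ⟨a, rfl⟩ : ∃ a, n = a + 1 := ⟨n - 1, by omega⟩
  have h1 : hPos (metallicK (a + 1)) (3 * a + 1 + 1) = (a + 1) * (a + 1 + 1) := by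
    rw [hPos_succ, hPos_succ, hPos_metallicK_first (show a < a + 1 by omega)]
    simp only [metallicK, interleave_zero, interleave_one, metallicK₀, metallicK₁]
    rw [if_pos (by omega), if_neg (by omega), if_pos trivial]
    ring_nf
    omega
  refine ⟨h1, ?_⟩
  rw [show 3 * (a + 1) = 3 * a + 1 + 1 + 1 by ring, hPos_succ, h1]
  simp only [metallicK, interleave_two, add_assoc, Nat.reduceAdd, metallicK₂]
  rw [if_neg (by omega), if_pos trivial]

theorem hPos_metallicK_symm (hn : 1 ≤ n) {q : ℕ} (hq : q ≤ 6 * n - 1) :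
    hPos (metallicK n) q + hPos (metallicK n) (6 * n - 1 - q) = (2 * n + 1) * (n + 1) := by
  have hstep : ∀ q, q + 1 ≤ 6 * n - 1 →
      hPos (metallicK n) q + hPos (metallicK n) (6 * n - 1 - q) =
        hPos (metallicK n) (q + 1) + hPos (metallicK n) (6 * n - 1 - (q + 1)) := fun q hq => by
    rw [show 6 * n - 1 - q = 6 * n - 1 - (q + 1) + 1 by omega, hPos_succ, hPos_succ,
      show 6 * n - 1 - (q + 1) = 6 * n - 2 - q by omega, metallicK_symm hn (by omega)]
    ring
  have hconst : ∀ q, q ≤ 6 * n - 1 → hPos (metallicK n) q + hPos (metallicK n) (6 * n - 1 - q) =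
      hPos (metallicK n) 0 + hPos (metallicK n) (6 * n - 1 - 0) := fun q hq => by
    induction q with
    | zero => rfl
    | succ q ih => rw [← hstep q hq, ih (by omega)]
  rw [hconst q hq, ← hconst (3 * n - 1) (by omega), show 6 * n - 1 - (3 * n - 1) = 3 * n by omega,
    (hPos_metallicK_central hn).1, (hPos_metallicK_central hn).2]
  ring

theorem hPos_metallicK_end (hn : 1 ≤ n) :
    hPos (metallicK n) (6 * n - 1) = (2 * n + 1) * (n + 1) := by
  have := hPos_metallicK_symm hn (q := 0) (by omega)
  rwa [hPos_zero, zero_add] at this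

theorem hPos_metallicK_period (hn : 2 ≤ n) :
    hPos (metallicK n) (6 * n - 4) = 2 * n * (n + 1) := by
  have h1 := hPos_metallicK_symm (n := n) (by omega) (q := 3) (by omega)
  have h2 := hPos_metallicK_first (n := n) (p := 1) (by omega)
  rw [show 6 * n - 1 - 3 = 6 * n - 4 by omega, show 3 = 3 * 1 from rfl, h2] at h1
  have : (2 * n + 1) * (n + 1) = 1 * (n + 1) + 2 * n * (n + 1) := by ring
  omega

/-- The partial products `v_0 ⋯ v_i` of the coefficients, for `i = 3p, 3p + 1, 3p + 2`. -/
theorem prod_metallicV (hn : 1 ≤ n) (p : ℕ) :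
    ∏ t ∈ Finset.range (3 * p + 1), metallicV n t = (-1) ^ (if p = n then p + 1 else p) ∧
    ∏ t ∈ Finset.range (3 * p + 1 + 1), metallicV n t =
      (-1) ^ (if p + 1 = n then p else p + 1) ∧
    ∏ t ∈ Finset.range (3 * p + 1 + 1 + 1), metallicV n t =
      (-1) ^ (if p + 1 = n then p + 1 else p) := by
  have h1 : ∀ p, ∏ t ∈ Finset.range (3 * p + 1), metallicV n t =
      (-1) ^ (if p = n then p + 1 else p) →
      ∏ t ∈ Finset.range (3 * p + 1 + 1), metallicV n t =
        (-1) ^ (if p + 1 = n then p else p + 1) := fun p h => by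
    rw [Finset.prod_range_succ, h, metallicV, interleave_one]
    by_cases h1 : p = n
    · simp [h1]
    · by_cases h2 : p + 1 = n
      · simp [h1, h2]
      · simp [h1, h2, pow_succ]
  have h2 : ∀ p, ∏ t ∈ Finset.range (3 * p + 1 + 1), metallicV n t =
      (-1) ^ (if p + 1 = n then p else p + 1) →
      ∏ t ∈ Finset.range (3 * p + 1 + 1 + 1), metallicV n t =
        (-1) ^ (if p + 1 = n then p + 1 else p) := fun p h => by
    rw [Finset.prod_range_succ, h, metallicV, show 3 * p + 1 + 1 = 3 * p + 2 by ring,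
      interleave_two]
    split_ifs <;> simp [pow_succ]
  have h0 : ∏ t ∈ Finset.range (3 * p + 1), metallicV n t =
      (-1) ^ (if p = n then p + 1 else p) := by
    induction p with
    | zero =>
      rw [if_neg (by omega), Finset.prod_range_succ, metallicV,
        interleave_zero]
      simp
    | succ p ih =>
      rw [Finset.prod_range_succ, show 3 * (p + 1) = 3 * p + 1 + 1 + 1 by ring,
        h2 p (h1 p ih), metallicV, show 3 * p + 1 + 1 + 1 = 3 * (p + 1) by ring, interleave_zero]
      split_ifs <;> simp_all [pow_succ]
  exact ⟨h0, h1 p h0, h2 p (h1 p h0)⟩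

theorem prod_metallicV_symm (hn : 1 ≤ n) {q : ℕ} (hq : q ≤ 6 * n - 2) :
    ∏ t ∈ Finset.range (6 * n - 2 - q + 1), metallicV n t =
      ∏ t ∈ Finset.range (q + 1), metallicV n t := by
  obtain ⟨p, rfl | rfl | rfl⟩ : ∃ p, q = 3 * p ∨ q = 3 * p + 1 ∨ q = 3 * p + 2 :=
    ⟨q / 3, by omega⟩
  · rw [show 6 * n - 2 - 3 * p + 1 = 3 * (2 * n - 1 - p) + 1 + 1 by omega,
      (prod_metallicV hn _).2.1, (prod_metallicV hn _).1]
    apply neg_one_pow_congr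
    rw [Nat.even_iff, Nat.even_iff]
    split_ifs <;> omega
  · rw [show 6 * n - 2 - (3 * p + 1) + 1 = 3 * (2 * n - 1 - p) + 1 by omega,
      (prod_metallicV hn _).2.1, (prod_metallicV hn _).1]
    apply neg_one_pow_congr
    rw [Nat.even_iff, Nat.even_iff]
    split_ifs <;> omega
  · rw [show 6 * n - 2 - (3 * p + 2) + 1 = 3 * (2 * n - 2 - p) + 1 + 1 + 1 by omega,
      show 3 * p + 2 + 1 = 3 * p + 1 + 1 + 1 by ring,
      (prod_metallicV hn _).2.2, (prod_metallicV hn _).2.2]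
    apply neg_one_pow_congr
    rw [Nat.even_iff, Nat.even_iff]
    split_ifs <;> omega

/-- The triangular numbers. -/
def tri (k : ℕ) : ℕ := k * (k + 1) / 2

theorem two_mul_tri (k : ℕ) : 2 * tri k = k * (k + 1) :=
  Nat.mul_div_cancel' (Nat.even_mul_succ_self k).two_dvd

theorem tri_add (a b : ℕ) : tri (a + b) = tri a + tri b + a * b := by
  have h1 := two_mul_tri (a + b)
  have h2 := two_mul_tri a
  have h3 := two_mul_tri b
  nlinarith

theorem tri_one : tri 1 = 1 := rfl

theorem tri_zero : tri 0 = 0 := rfl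

theorem mul_pred_div_two (n : ℕ) : n * (n - 1) / 2 = tri (n - 1) := by
  cases n with
  | zero => rfl
  | succ n => rw [tri, Nat.add_sub_cancel, mul_comm]

/-- The value of the nonzero Hankel determinant number `q` of the `q`-metallic number. -/
noncomputable def metallicSign (n : ℕ) : ℕ → ℚ := hSign (metallicK n) (metallicV n)

theorem metallicSign_succ (n q : ℕ) : metallicSign n (q + 1) =
    metallicSign n q * (-1) ^ tri (metallicK n q) *
      (∏ t ∈ Finset.range (q + 1), metallicV n t) ^ (metallicK n q + 1) := rfl

theorem metallicSign_step₀ (hn : 1 ≤ n) (p : ℕ) : metallicSign n (3 * p + 1) =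
    metallicSign n (3 * p) * (-1) ^ (tri (metallicK₀ n p) +
      (if p = n then p + 1 else p) * (metallicK₀ n p + 1)) := by
  rw [metallicSign_succ, (prod_metallicV hn p).1, metallicK, interleave_zero,
    pow_add (-1 : ℚ), pow_mul, mul_assoc]

theorem metallicSign_step₁ (hn : 1 ≤ n) (p : ℕ) : metallicSign n (3 * p + 2) =
    metallicSign n (3 * p + 1) * (-1) ^ (tri (metallicK₁ n p) +
      (if p + 1 = n then p else p + 1) * (metallicK₁ n p + 1)) := by
  rw [show 3 * p + 2 = 3 * p + 1 + 1 by ring, metallicSign_succ, (prod_metallicV hn p).2.1,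
    metallicK, interleave_one, pow_add (-1 : ℚ), pow_mul, mul_assoc]

theorem metallicSign_step₂ (hn : 1 ≤ n) (p : ℕ) : metallicSign n (3 * (p + 1)) =
    metallicSign n (3 * p + 2) * (-1) ^ (tri (metallicK₂ n p) +
      (if p + 1 = n then p + 1 else p) * (metallicK₂ n p + 1)) := by
  rw [show 3 * (p + 1) = 3 * p + 2 + 1 by ring, metallicSign_succ,
    show 3 * p + 2 + 1 = 3 * p + 1 + 1 + 1 by ring, (prod_metallicV hn p).2.2,
    metallicK, interleave_two, pow_add (-1 : ℚ), pow_mul, mul_assoc]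

theorem metallicSign_first {p : ℕ} (hp : p < n) :
    metallicSign n (3 * p) = (-1) ^ (p * tri (n - 1) + tri p + p) ∧
    metallicSign n (3 * p + 1) = (-1) ^ (p * tri (n - 1) + tri p) ∧
    (p + 1 < n → metallicSign n (3 * p + 2) = (-1) ^ ((p + 1) * tri (n - 1))) := by
  have h1 : ∀ p, p < n → metallicSign n (3 * p) = (-1) ^ (p * tri (n - 1) + tri p + p) →
      metallicSign n (3 * p + 1) = (-1) ^ (p * tri (n - 1) + tri p) := fun p hp h => by
    rw [metallicSign_step₀ (by omega), h, metallicK₀, if_pos hp, if_neg (by omega), tri_zero,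
      ← pow_add]
    apply neg_one_pow_congr
    simp only [Nat.even_add, Nat.even_mul, Nat.even_add_one]
    grind
  have h2 : ∀ p, p + 1 < n → metallicSign n (3 * p + 1) = (-1) ^ (p * tri (n - 1) + tri p) →
      metallicSign n (3 * p + 2) = (-1) ^ ((p + 1) * tri (n - 1)) := fun p hp h => by
    rw [metallicSign_step₁ (by omega), h, metallicK₁, if_pos hp, if_neg (by omega), ← pow_add]
    obtain ⟨m, rfl⟩ : ∃ m, n = p + 1 + m + 1 := ⟨n - p - 2, by omega⟩
    rw [show p + 1 + m + 1 - 2 - p = m by omega, Nat.add_sub_cancel, tri_add (p + 1) m,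
      tri_add p 1, tri_one]
    apply neg_one_pow_congr
    simp only [Nat.even_add, Nat.even_mul, Nat.even_add_one]
    grind
  have h0 : metallicSign n (3 * p) = (-1) ^ (p * tri (n - 1) + tri p + p) := by
    induction p with
    | zero => simp [metallicSign, hSign, tri_zero]
    | succ p ih =>
      rw [metallicSign_step₂ (by omega), h2 p hp (h1 p (by omega) (ih (by omega))), metallicK₂,
        if_pos hp, if_neg (by omega), ← pow_add, tri_add p 1, tri_one]
      apply neg_one_pow_congr
      simp only [Nat.even_add, Nat.even_mul, Nat.even_add_one]
      grind
  exact ⟨h0, h1 p hp h0, fun hp' => h2 p hp' (h1 p hp h0)⟩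

theorem metallicSign_central (hn : 1 ≤ n) :
    metallicSign n (3 * (n - 1) + 2) = (-1) ^ ((n - 1) * tri (n - 1)) ∧
    metallicSign n (3 * n) = (-1) ^ ((n - 1) * tri (n - 1) + tri n) ∧
    metallicSign n (3 * n + 1) = (-1) ^ (n * tri (n - 1) + tri n) := by
  obtain ⟨a, rfl⟩ : ∃ a, n = a + 1 := ⟨n - 1, by omega⟩
  rw [Nat.add_sub_cancel]
  have h2 : metallicSign (a + 1) (3 * a + 2) = (-1) ^ (a * tri a) := by
    have := (metallicSign_first (show a < a + 1 by omega)).2.1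
    rw [Nat.add_sub_cancel] at this
    rw [metallicSign_step₁ hn, this, metallicK₁, if_neg (by omega), if_pos rfl, if_pos rfl,
      ← pow_add, Nat.add_sub_cancel]
    apply neg_one_pow_congr
    simp only [Nat.even_add, Nat.even_mul, Nat.even_add_one]
    grind
  have h3 : metallicSign (a + 1) (3 * (a + 1)) = (-1) ^ (a * tri a + tri (a + 1)) := by
    rw [metallicSign_step₂ hn, h2, metallicK₂, if_neg (by omega), if_pos rfl, if_pos rfl,
      ← pow_add]
    apply neg_one_pow_congr
    simp only [Nat.even_add, Nat.even_mul, Nat.even_add_one]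
    grind
  refine ⟨h2, h3, ?_⟩
  rw [metallicSign_step₀ hn, h3, metallicK₀, if_neg (by omega), if_pos rfl, if_pos rfl,
    ← pow_add, Nat.add_sub_cancel]
  apply neg_one_pow_congr
  simp only [Nat.even_add, Nat.even_mul, Nat.even_add_one]
  grind

theorem metallicSign_second (hn : 1 ≤ n) {p : ℕ} (hnp : n ≤ p) (hp : p < 2 * n) :
    metallicSign n (3 * p + 1) = (-1) ^ (p * tri (n - 1) + tri p) ∧
    metallicSign n (3 * p + 2) = (-1) ^ (p * tri (n - 1) + tri (p + 1)) ∧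
    (p + 1 < 2 * n →
      metallicSign n (3 * (p + 1)) = (-1) ^ ((p + 2) * tri (n - 1) + n)) := by
  have h2 : ∀ p, n ≤ p → metallicSign n (3 * p + 1) = (-1) ^ (p * tri (n - 1) + tri p) →
      metallicSign n (3 * p + 2) = (-1) ^ (p * tri (n - 1) + tri (p + 1)) := fun p hp h => by
    rw [metallicSign_step₁ hn, h, metallicK₁, if_neg (by omega), if_neg (by omega),
      if_neg (by omega), ← pow_add, tri_zero, tri_add p 1, tri_one]
    apply neg_one_pow_congr
    simp only [Nat.even_add, Nat.even_mul, Nat.even_add_one, Even.zero]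
    grind
  have h3 : ∀ p, n ≤ p → p + 1 < 2 * n →
      metallicSign n (3 * p + 2) = (-1) ^ (p * tri (n - 1) + tri (p + 1)) →
      metallicSign n (3 * (p + 1)) = (-1) ^ ((p + 2) * tri (n - 1) + n) := fun p hp hp' h => by
    rw [metallicSign_step₂ hn, h, metallicK₂, if_neg (by omega), if_neg (by omega),
      if_neg (by omega), ← pow_add]
    -- `(p + 1) + (2n - 2 - p) = n + (n - 1)`, so the triangular numbers are related
    obtain ⟨m, hm⟩ : ∃ m, 2 * n = p + 2 + m := ⟨2 * n - 2 - p, by omega⟩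
    have e1 := tri_add (p + 1) m
    rw [show p + 1 + m = n + (n - 1) by omega, tri_add n (n - 1)] at e1
    have e2 := tri_add (n - 1) 1
    rw [Nat.sub_add_cancel hn, tri_one] at e2
    rw [show 2 * n - 2 - p = m by omega]
    have e3 : Even (p + m) := ⟨n - 1, by omega⟩
    have e4 : Even (n * (n - 1)) := Nat.even_mul_pred_self n
    have e5 : Even n ↔ ¬ Even (n - 1) := by
      rw [← Nat.even_add_one, Nat.sub_add_cancel hn]
    have e6 := congrArg Even e1
    have e7 := congrArg Even e2
    apply neg_one_pow_congr
    simp only [Nat.even_add, Nat.even_mul, Nat.even_add_one, eq_iff_iff,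
      mul_one] at e3 e4 e6 e7 ⊢
    grind
  have h1 : metallicSign n (3 * p + 1) = (-1) ^ (p * tri (n - 1) + tri p) := by
    induction p, hnp using Nat.le_induction with
    | base => exact (metallicSign_central hn).2.2
    | succ p hp' ih =>
      rw [metallicSign_step₀ hn, h3 p hp' hp (h2 p hp' (ih (by omega))), metallicK₀,
        if_neg (by omega), if_neg (by omega), if_neg (by omega), ← pow_add]
      obtain ⟨r, rfl⟩ : ∃ r, p = n + r := ⟨p - n, by omega⟩
      rw [show n + r + 1 - n - 1 = r by omega, tri_add (n + r) 1, tri_one, tri_add n r]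
      have e2 := tri_add (n - 1) 1
      rw [Nat.sub_add_cancel hn, tri_one, mul_one] at e2
      have e5 : Even n ↔ ¬ Even (n - 1) := by
        rw [← Nat.even_add_one, Nat.sub_add_cancel hn]
      have e7 := congrArg Even e2
      apply neg_one_pow_congr
      simp only [Nat.even_add, Nat.even_mul, Nat.even_add_one, eq_iff_iff,
        mul_one] at e7 ⊢
      grind
  exact ⟨h1, h2 p hnp h1, fun h => h3 p hnp h (h2 p hnp h1)⟩

theorem metallicSign_sq (n q : ℕ) :
    metallicSign n q * metallicSign n q = 1 := by
  induction q with
  | zero => simp [metallicSign, hSign]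
  | succ q ih =>
    have hprod : (∏ t ∈ Finset.range (q + 1), metallicV n t) *
        (∏ t ∈ Finset.range (q + 1), metallicV n t) = 1 := by
      rw [← Finset.prod_mul_distrib]
      refine Finset.prod_eq_one fun t _ => ?_
      simp only [metallicV, interleave]
      split_ifs <;> norm_num
    rw [metallicSign_succ]
    have h1 : ((-1 : ℚ) ^ tri (metallicK n q)) * (-1) ^ tri (metallicK n q) = 1 := by
      rw [← mul_pow]; norm_num
    have h2 := congrArg (· ^ (metallicK n q + 1)) hprod
    simp only [mul_pow, one_pow] at h2
    linear_combination h2 + ih * (((-1 : ℚ) ^ tri (metallicK n q)) * (-1) ^ tri (metallicK n q) *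
      ((∏ t ∈ Finset.range (q + 1), metallicV n t) ^ (metallicK n q + 1) *
      (∏ t ∈ Finset.range (q + 1), metallicV n t) ^ (metallicK n q + 1))) +
      h1 * ((∏ t ∈ Finset.range (q + 1), metallicV n t) ^ (metallicK n q + 1) *
      (∏ t ∈ Finset.range (q + 1), metallicV n t) ^ (metallicK n q + 1))

/-- The factors from one nonzero determinant to the next form a palindrome, so the product of two
determinants in symmetric positions does not depend on the position; it is read off at the
center. -/
theorem metallicSign_symm (hn : 1 ≤ n) {q : ℕ} (hq : q ≤ 6 * n - 1) :
    metallicSign n q * metallicSign n (6 * n - 1 - q) = (-1) ^ tri n := by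
  have hstep : ∀ q, q + 1 ≤ 6 * n - 1 →
      metallicSign n q * metallicSign n (6 * n - 1 - q) =
        metallicSign n (q + 1) * metallicSign n (6 * n - 1 - (q + 1)) := fun q hq => by
    rw [show 6 * n - 1 - q = 6 * n - 1 - (q + 1) + 1 by omega, metallicSign_succ,
      metallicSign_succ, show 6 * n - 1 - (q + 1) = 6 * n - 2 - q by omega,
      metallicK_symm hn (by omega), prod_metallicV_symm hn (by omega)]
    ring
  have hconst : ∀ q, q ≤ 6 * n - 1 → metallicSign n q * metallicSign n (6 * n - 1 - q) =
      metallicSign n 0 * metallicSign n (6 * n - 1 - 0) := fun q hq => by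
    induction q with
    | zero => rfl
    | succ q ih => rw [← hstep q hq, ih (by omega)]
  rw [hconst q hq, ← hconst (3 * n - 1) (by omega), show 6 * n - 1 - (3 * n - 1) = 3 * n by omega,
    (metallicSign_central hn).2.1, show 3 * n - 1 = 3 * (n - 1) + 2 by omega,
    (metallicSign_central hn).1, pow_add, ← mul_assoc, ← pow_add]
  rw [(Even.add_self ((n - 1) * tri (n - 1))).neg_one_pow, one_mul]

end Signs

/-! ### Hankel determinants of the `q`-metallic number -/

section Main

variable {n : ℕ} {G : PowerSeries ℚ}

theorem hankel_metallic (hn : 1 ≤ n) (hG : IsAuxSeries n G) {q : ℕ} (hq : q ≤ 6 * n - 1) :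
    hankel (quotE G (n - 1)) (hPos (metallicK n) q) = metallicSign n q := by
  rw [← metallicF_zero]
  exact hankel_chain (F := metallicF n G) (P := 6 * n - 1)
    (fun i hi => isHStep_metallic hn hG hi) hq

theorem hankel_metallic_ne_zero_iff (hn : 1 ≤ n) (hG : IsAuxSeries n G) {j : ℕ}
    (hj : j ≤ (2 * n + 1) * (n + 1)) : hankel (quotE G (n - 1)) j ≠ 0 ↔
      ∃ q ≤ 6 * n - 1, j = hPos (metallicK n) q := by
  rw [← metallicF_zero]
  exact hankel_chain_ne_zero_iff (F := metallicF n G) (P := 6 * n - 1)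
    (fun i hi => isHStep_metallic hn hG hi)
    (hj.trans_eq (hPos_metallicK_end hn).symm)

theorem hankel_metallic_symm (hn : 1 ≤ n) (hG : IsAuxSeries n G) {j : ℕ}
    (hj : j ≤ (2 * n + 1) * (n + 1)) : hankel (quotE G (n - 1)) j =
      (-1) ^ tri n * hankel (quotE G (n - 1)) ((2 * n + 1) * (n + 1) - j) := by
  by_cases h0 : hankel (quotE G (n - 1)) j = 0
  · by_cases h1 : hankel (quotE G (n - 1)) ((2 * n + 1) * (n + 1) - j) = 0
    · rw [h0, h1, mul_zero]
    · obtain ⟨q, hq, hjq⟩ := (hankel_metallic_ne_zero_iff hn hG (Nat.sub_le _ _)).1 h1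
      have hsymm := hPos_metallicK_symm hn hq
      exact absurd h0 ((hankel_metallic_ne_zero_iff hn hG hj).2
        ⟨6 * n - 1 - q, Nat.sub_le _ _, by omega⟩)
  · obtain ⟨q, hq, rfl⟩ := (hankel_metallic_ne_zero_iff hn hG hj).1 h0
    have hsymm := hPos_metallicK_symm hn hq
    rw [show (2 * n + 1) * (n + 1) - hPos (metallicK n) q =
      hPos (metallicK n) (6 * n - 1 - q) by omega, hankel_metallic hn hG hq,
      hankel_metallic hn hG (Nat.sub_le _ _), ← metallicSign_symm hn hq, mul_assoc,
      metallicSign_sq, mul_one]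

/-- The positions of the nonzero determinants do not depend on the expansion. -/
theorem metallic_s_eq (hn : 1 ≤ n) (hG : IsAuxSeries n G) {H : HFraction ℚ}
    (hH : H.IsExpansionOf (quotE G (n - 1))) {q : ℕ} (hq : q ≤ 6 * n - 1) :
    H.s q = hPos (metallicK n) q := by
  refine eq_of_same_values H.s_strictMono (hPos_strictMono _) (fun j hj => ?_) hq
  rw [← hH.hankel_ne_zero_iff]
  exact hankel_metallic_ne_zero_iff hn hG (hj.trans_eq (hPos_metallicK_end hn))

theorem hankel_metallic_s (hn : 1 ≤ n) (hG : IsAuxSeries n G) {H : HFraction ℚ}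
    (hH : H.IsExpansionOf (quotE G (n - 1))) {q : ℕ} (hq : q ≤ 6 * n - 1) :
    hankel (quotE G (n - 1)) (H.s q) = metallicSign n q := by
  rw [metallic_s_eq hn hG hH hq, hankel_metallic hn hG hq]

theorem mul_mul_div_two_eq (n : ℕ) : n * (n + 1) * (n + 2) / 2 = tri n * (n + 2) := by
  rw [← two_mul_tri, mul_assoc, Nat.mul_div_cancel_left _ two_pos]

theorem mul_sq_div_two_eq (n : ℕ) : n * (n - 1) ^ 2 / 2 = (n - 1) * tri (n - 1) := by
  cases n with
  | zero => rfl
  | succ n =>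
    rw [Nat.add_sub_cancel, show (n + 1) * n ^ 2 = n * (n + 1) * n by ring, ← two_mul_tri,
      mul_assoc, Nat.mul_div_cancel_left _ two_pos, mul_comm]

theorem tri_pred_add (p : ℕ) : p * (p - 1) / 2 + p = tri p := by
  rw [mul_pred_div_two]
  cases p with
  | zero => rfl
  | succ p => rw [Nat.add_sub_cancel, tri_add p 1, tri_one]; ring

end Main

theorem mainTheorem5 (n : ℕ) (hn : 1 ≤ n) :
    ∃ Φ : PowerSeries ℚ, IsQMetallic n Φ ∧
      -- symmetry
      (∀ j : ℕ, j ≤ (2 * n + 1) * (n + 1) →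
        hankelDet (fun i => Φ.coeff i) 0 j =
          (-1) ^ (n * (n + 1) / 2) *
            hankelDet (fun i => Φ.coeff i) 0 ((2 * n + 1) * (n + 1) - j)) ∧
      -- position and values of the nonzero determinants
      (2 ≤ n →
        (∃ H : HFraction ℚ, H.IsExpansionOf Φ) ∧
        ∀ H : HFraction ℚ, H.IsExpansionOf Φ →
          (∀ j : ℕ,
            (j < 2 * n * (n + 1) ∧ hankelDet (fun i => Φ.coeff i) 0 j ≠ 0) ↔
              ∃ q : ℕ, q ≤ 6 * n - 5 ∧ j = H.s q) ∧
          -- indices congruent to 0 modulo 3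
          (∀ p : ℕ, p ≤ n - 1 →
            hankelDet (fun i => Φ.coeff i) 0 (H.s (3 * p)) =
              (-1) ^ (p * (n * (n - 1) / 2)) * (-1) ^ (p * (p - 1) / 2)) ∧
          hankelDet (fun i => Φ.coeff i) 0 (H.s (3 * n)) =
            (-1) ^ (n * (n + 1) * (n + 2) / 2) ∧
          (∀ p : ℕ, n + 1 ≤ p → p ≤ 2 * n - 2 →
            hankelDet (fun i => Φ.coeff i) 0 (H.s (3 * p)) =
              (-1) ^ ((p + 1) * (n * (n - 1) / 2)) * (-1) ^ n) ∧
          -- indices congruent to 1 modulo 3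
          (∀ p : ℕ, p ≤ 2 * n - 2 →
            hankelDet (fun i => Φ.coeff i) 0 (H.s (3 * p + 1)) =
              (-1) ^ (p * (n * (n - 1) / 2)) * (-1) ^ (p * (p + 1) / 2)) ∧
          -- indices congruent to 2 modulo 3
          (∀ p : ℕ, p ≤ n - 2 →
            hankelDet (fun i => Φ.coeff i) 0 (H.s (3 * p + 2)) =
              (-1) ^ ((p + 1) * (n * (n - 1) / 2))) ∧
          hankelDet (fun i => Φ.coeff i) 0 (H.s (3 * (n - 1) + 2)) =
            (-1) ^ (n * (n - 1) ^ 2 / 2) ∧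
          (∀ p : ℕ, n ≤ p → p ≤ 2 * n - 3 →
            hankelDet (fun i => Φ.coeff i) 0 (H.s (3 * p + 2)) =
              (-1) ^ (p * (n * (n - 1) / 2)) * (-1) ^ ((p + 1) * (p + 2) / 2))) := by
  obtain ⟨G, hG⟩ := exists_isAuxSeries hn
  refine ⟨quotE G (n - 1), isQMetallic_quotE hn hG, fun j hj => hankel_metallic_symm hn hG hj,
    fun hn2 => ⟨exists_isExpansionOf_metallic hn2 hG, fun H hH => ?_⟩⟩
  have hs : ∀ q ≤ 6 * n - 1, hankelDet (fun i => (quotE G (n - 1)).coeff i) 0 (H.s q) =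
      metallicSign n q := fun q hq => hankel_metallic_s hn hG hH hq
  refine ⟨fun j => ?_, fun p hp => ?_, ?_, fun p hp hp' => ?_, fun p hp => ?_, fun p hp => ?_,
    ?_, fun p hp hp' => ?_⟩
  · rw [hH.hankel_ne_zero_iff, ← hPos_metallicK_period hn2,
      ← metallic_s_eq hn hG hH (by omega)]
    constructor
    · rintro ⟨hj, q, rfl⟩
      have := H.s_strictMono.lt_iff_lt.1 hj
      exact ⟨q, by omega, rfl⟩
    · rintro ⟨q, hq, rfl⟩
      exact ⟨H.s_strictMono (by omega), q, rfl⟩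
  · rw [hs _ (by omega), (metallicSign_first (by omega)).1, mul_pred_div_two n, ← pow_add,
      ← tri_pred_add p]
    apply neg_one_pow_congr
    simp only [Nat.even_add]
    grind
  · rw [hs _ (by omega), (metallicSign_central hn).2.1, mul_mul_div_two_eq]
    have e := tri_add (n - 1) 1
    rw [Nat.sub_add_cancel hn, tri_one, mul_one] at e
    have e1 : Even n ↔ ¬ Even (n - 1) := by
      rw [← Nat.even_add_one, Nat.sub_add_cancel hn]
    have e2 := congrArg Even e
    apply neg_one_pow_congr
    simp only [Nat.even_add, Nat.even_mul, Nat.even_add_one, eq_iff_iff] at e2 ⊢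
    grind
  · obtain ⟨r, rfl⟩ : ∃ r, p = r + 1 := ⟨p - 1, by omega⟩
    rw [hs _ (by omega), (metallicSign_second hn (by omega) (by omega)).2.2 (by omega),
      mul_pred_div_two n, ← pow_add]
  · rw [hs _ (by omega), mul_pred_div_two n, ← pow_add]
    rcases lt_or_ge p n with h | h
    · exact (metallicSign_first h).2.1
    · exact (metallicSign_second hn h (by omega)).1
  · rw [hs _ (by omega), (metallicSign_first (by omega)).2.2 (by omega), mul_pred_div_two n]
  · rw [hs _ (by omega), (metallicSign_central hn).1, mul_sq_div_two_eq]
  · rw [hs _ (by omega), (metallicSign_second hn hp (by omega)).2.1, mul_pred_div_two n, ← pow_add]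
    rfl
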